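/- Let $(\mathbb X,\nu)$ and $(\Theta,\mu)$ be measurable spaces with countably generated $\sigma$-algebras and $\sigma$-finite reference measures, and let $n\ge 0$. Let $f(\cdot\mid\theta)$, $\theta\in\Theta$, be probability densities on $\mathbb X$ with respect to $\nu$, jointly measurable in $(\theta,x)$; a database $x=(x_1,\dots,x_n)\in\mathbb X^n$ has likelihood $f(x\mid\theta)=\prod_{i=1}^n f(x_i\mid\theta)$. Let $p$ be a measurable prior density on $\Theta$ with respect to $\mu$. Let $\eta(\cdot\mid x)$, $x\in\mathbb X^n$, be the probability densities (jointly measurable) of a privacy mechanism, and fix an output $s_{\mathrm{dp}}$ with $p(s_{\mathrm{dp}})=\int\!\!\int p(\theta)f(x\mid\theta)\eta(s_{\mathrm{dp}}\mid x)\,dx\,d\theta<\infty$, so that the joint posterior $\pi(x,\theta)=p(x,\theta\mid s_{\mathrm{dp}})\propto p(\theta)f(x\mid\theta)\eta(s_{\mathrm{dp}}\mid x)$ is well defined. Let $K(x,\theta;d\theta')$ be a Markov kernel from $\mathbb X^n\times\Theta$ to $\Theta$ that targets $p(\theta\mid x)\propto p(\theta)f(x\mid\theta)$ in the following sense: for every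 $x$ with $0<\int p(\theta)f(x\mid\theta)\,d\theta<\infty$, the kernel $K(x,\cdot\,;\cdot)$ leaves $p(\cdot\mid x)$ invariant, and $K(x,\theta;B)>0$ for every $\theta\in\Theta$ and every measurable $B$ of positive $p(\cdot\mid x)$-probability. (The latter holds for exact draws from $p(\cdot\mid x)$ and for Metropolis–Hastings updates with everywhere positive proposal density.) Consider the Markov chain on $\mathbb X^n\times\Theta$, with transition kernel $P$, one iteration of which, from $(x,\theta)$, is: 1. replace $\theta$ by a draw from $K(x,\theta;\cdot)$; 2. for $i=1,\dots,n$ in turn, propose $x_i^\star\sim f(\cdot\mid\theta)$ and replace $x_i$ by $x_i^\star$ with probability $\min\{\eta(s_{\mathrm{dp}}\mid x_i^\star,x_{-i})/\eta(s_{\mathrm{dp}}\mid x_i,x_{-i}),\,1\}$, keeping $x_i$ otherwise. Assume: A1. The prior is proper, $\int p\,d\mu=1$, and $p(\theta)>0$ for every $\theta$ in $\{\theta: f(x\mid\theta)>0\text{ for some }x\in\mathbb X\}$ (which is all of $\Theta$). A2. The set $\{x\in\mathbb X: f(x\mid\theta)>0\}$ does not depend on $\theta$. A3. $\eta(s_{\mathrm{dp}}\mid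 x)>0$ for all $x\in\mathbb X^n$. Then the chain is ergodic with limit $\pi$: $\pi$ is an invariant probability distribution of $P$; $P$ is $\pi$-irreducible (from every starting point, every set of positive $\pi$-measure is reached with positive probability in some number of steps) and aperiodic; and for $\pi$-almost every starting point $z$, $\sup_A|P^m(z,A)-\pi(A)|\to 0$ as $m\to\infty$. Moreover $\pi$ is the unique invariant probability distribution of $P$ and the unique limiting distribution: if for some starting point $z\in\mathbb X^n\times\Theta$ the laws $P^m(z,\cdot)$ converge in total variation to a probability distribution, then this distribution is $\pi$. -/

import Mathlib

open MeasureTheory ProbabilityTheory Filter Topology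
open scoped NNReal ENNReal

noncomputable section

namespace PrivacySampler

/-- A statistical model for a single record: for every parameter `θ`, the function `f(· ∣ θ)` is a
probability density on the record space `X` with respect to the reference measure `ν`,
jointly measurable in `(θ, x)`. -/
structure RecordModel (X Θ : Type*) [MeasurableSpace X] [MeasurableSpace Θ] (ν : Measure X) where
  density : Θ → X → ℝ≥0
  measurable_density : Measurable fun z : Θ × X => density z.1 z.2
  lintegral_density : ∀ θ, ∫⁻ x, (density θ x : ℝ≥0∞) ∂ν = 1

/-- A privacy mechanism on databases of `n` records: for every database `x`, the function
`η(· ∣ x)` is a probability density on the output space `S` with respect to the reference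
measure `ρ`, jointly measurable in `(s, x)`. -/
structure PrivacyMechanism (n : ℕ) (X S : Type*) [MeasurableSpace X] [MeasurableSpace S]
    (ρ : Measure S) where
  density : S → (Fin n → X) → ℝ≥0
  measurable_density : Measurable fun z : S × (Fin n → X) => density z.1 z.2
  lintegral_density : ∀ x, ∫⁻ s, (density s x : ℝ≥0∞) ∂ρ = 1

/-- The state space `X^n × Θ` of the sampler. -/
abbrev State (n : ℕ) (X Θ : Type*) : Type _ := (Fin n → X) × Θ

/-- The probability measure proportional to `m` (meaningful when `0 < m univ < ∞`). -/
def normalize {α : Type*} [MeasurableSpace α] (m : Measure α) : Measure α :=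
  (m Set.univ)⁻¹ • m

section Posteriors

variable {n : ℕ} {X Θ S : Type*} [MeasurableSpace X] [MeasurableSpace Θ] [MeasurableSpace S]
  {ν : Measure X} {ρ : Measure S}

/-- The likelihood `f(x ∣ θ) = ∏ i, f(x i ∣ θ)` of a database of i.i.d. records. -/
def likelihood (f : RecordModel X Θ ν) (x : Fin n → X) (θ : Θ) : ℝ≥0 :=
  ∏ i, f.density θ (x i)

/-- The unnormalised posterior `p(θ) f(x ∣ θ) dθ` of the parameter given the database `x`. -/
def paramWeight (μ : Measure Θ) (prior : Θ → ℝ≥0) (f : RecordModel X Θ ν) (x : Fin n → X) :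
    Measure Θ :=
  μ.withDensity fun θ => ((prior θ * likelihood f x θ : ℝ≥0) : ℝ≥0∞)

/-- The posterior `p(θ ∣ x) ∝ p(θ) f(x ∣ θ)` of the parameter given the database `x`. -/
def paramPosterior (μ : Measure Θ) (prior : Θ → ℝ≥0) (f : RecordModel X Θ ν) (x : Fin n → X) :
    Measure Θ :=
  normalize (paramWeight μ prior f x)

/-- The unnormalised joint posterior `p(θ) f(x ∣ θ) η(s ∣ x) dx dθ`; its total mass is the
marginal density `p(s)` of the privatised output `s`. -/
def jointWeight (μ : Measure Θ) (prior : Θ → ℝ≥0) (f : RecordModel X Θ ν)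
    (η : PrivacyMechanism n X S ρ) (s : S) : Measure (State n X Θ) :=
  ((Measure.pi fun _ : Fin n => ν).prod μ).withDensity fun z =>
    ((prior z.2 * likelihood f z.1 z.2 * η.density s z.1 : ℝ≥0) : ℝ≥0∞)

/-- The joint posterior `p(x, θ ∣ s) ∝ p(θ) f(x ∣ θ) η(s ∣ x)`. -/
def jointPosterior (μ : Measure Θ) (prior : Θ → ℝ≥0) (f : RecordModel X Θ ν)
    (η : PrivacyMechanism n X S ρ) (s : S) : Measure (State n X Θ) :=
  normalize (jointWeight μ prior f η s)

/-- `K` is a valid conditional update for `p(θ ∣ x)`. Here `K (x, θ)` is the law of the new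
parameter when the current state is `(x, θ)`. For every database `x` at which `p(θ ∣ x)` is a
well-defined probability distribution (its normalising constant is neither `0` nor `∞`), the
kernel `K (x, ·)` leaves `p(θ ∣ x)` invariant and, from every current parameter value, charges
every set that `p(θ ∣ x)` charges. The second requirement holds for exact draws from
`p(θ ∣ x)` and for Metropolis-Hastings updates whose proposal density is positive on `Θ`. -/
def TargetsPosterior (μ : Measure Θ) (prior : Θ → ℝ≥0) (f : RecordModel X Θ ν)
    (K : Kernel (State n X Θ) Θ) : Prop :=
  ∀ x : Fin n → X,
    paramWeight μ prior f x Set.univ ≠ 0 → paramWeight μ prior f x Set.univ ≠ ∞ →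
      Kernel.Invariant (K.sectR x) (paramPosterior μ prior f x) ∧
      ∀ (θ : Θ) (B : Set Θ), MeasurableSet B → 0 < paramPosterior μ prior f x B →
        0 < K (x, θ) B

end Posteriors

section Sampler

variable {n : ℕ} {X Θ S : Type*} [MeasurableSpace X] [MeasurableSpace Θ] [MeasurableSpace S]
  {ν : Measure X} {ρ : Measure S}

/-- The proposal kernel for a single record: `x⋆ ∼ f(· ∣ θ)`, when the current state
is `(x, θ)`. -/
def proposal (n : ℕ) [SFinite ν] (f : RecordModel X Θ ν) : Kernel (State n X Θ) X :=
  Kernel.withDensity (Kernel.const (State n X Θ) ν) fun z y => (f.density z.2 y : ℝ≥0∞)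

/-- The acceptance probability `min {η(s ∣ x⋆, x₋ᵢ) / η(s ∣ x), 1}` of the proposal `y` for
the `i`-th record of `x`. -/
def acceptProb (η : PrivacyMechanism n X S ρ) (s : S) (i : Fin n) (x : Fin n → X) (y : X) : ℝ≥0 :=
  min (η.density s (Function.update x i y) / η.density s x) 1

theorem measurable_update_record (i : Fin n) :
    Measurable fun w : State n X Θ × X => Function.update w.1.1 i w.2 := by
  refine measurable_pi_iff.2 fun j => ?_
  by_cases h : j = i
  · subst h
    simpa using measurable_snd
  · simp only [Function.update_of_ne h]
    fun_prop

theorem measurable_acceptProb (η : PrivacyMechanism n X S ρ) (s : S) (i : Fin n) :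
    Measurable fun w : State n X Θ × X => acceptProb η s i w.1.1 w.2 := by
  have h1 : Measurable fun w : State n X Θ × X => η.density s (Function.update w.1.1 i w.2) :=
    η.measurable_density.comp (measurable_const.prodMk (measurable_update_record i))
  have h2 : Measurable fun w : State n X Θ × X => η.density s w.1.1 :=
    η.measurable_density.comp (measurable_const.prodMk (measurable_fst.comp measurable_fst))
  exact (h1.div h2).min measurable_const

/-- The accept/reject step for record `i`: from the state `(x, θ)` and the proposal `y`, move to
`(x with x i replaced by y, θ)` with the acceptance probability, and stay at `(x, θ)`
otherwise. -/
def acceptReject (η : PrivacyMechanism n X S ρ) (s : S) (i : Fin n) :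
    Kernel (State n X Θ × X) (State n X Θ) where
  toFun w :=
    (acceptProb η s i w.1.1 w.2 : ℝ≥0∞) • Measure.dirac (Function.update w.1.1 i w.2, w.1.2)
      + ((1 - acceptProb η s i w.1.1 w.2 : ℝ≥0) : ℝ≥0∞) • Measure.dirac w.1
  measurable' := by
    refine Measure.measurable_of_measurable_coe _ fun A hA => ?_
    have hα := measurable_acceptProb (Θ := Θ) η s i
    have hm : Measurable fun w : State n X Θ × X =>
        ((Function.update w.1.1 i w.2, w.1.2) : State n X Θ) :=
      (measurable_update_record i).prodMk (measurable_snd.comp measurable_fst)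
    simp only [Measure.add_apply, Measure.smul_apply, smul_eq_mul, Measure.dirac_apply' _ hA]
    refine (hα.coe_nnreal_ennreal.mul ?_).add
      ((measurable_const.sub hα).coe_nnreal_ennreal.mul ?_)
    · exact (measurable_one.indicator hA).comp hm
    · exact (measurable_one.indicator hA).comp measurable_fst

/-- The Metropolis-Hastings update of the `i`-th record: propose from `f(· ∣ θ)`, then accept or
reject. -/
def recordUpdate [SFinite ν] (f : RecordModel X Θ ν) (η : PrivacyMechanism n X S ρ) (s : S)
    (i : Fin n) : Kernel (State n X Θ) (State n X Θ) :=
  acceptReject η s i ∘ₖ (Kernel.id ×ₖ proposal n f)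

/-- The sequential sweep that updates the records `0, 1, …, n - 1` one after the other. -/
def recordSweep [SFinite ν] (f : RecordModel X Θ ν) (η : PrivacyMechanism n X S ρ) (s : S) :
    Kernel (State n X Θ) (State n X Θ) :=
  (List.finRange n).foldl (fun κ i => recordUpdate f η s i ∘ₖ κ) Kernel.id

/-- The update of the parameter with the kernel `K`, the database being kept. -/
def paramUpdate (K : Kernel (State n X Θ) Θ) : Kernel (State n X Θ) (State n X Θ) :=
  Kernel.deterministic Prod.fst measurable_fst ×ₖ K

/-- One iteration of the privacy-aware Metropolis-within-Gibbs sampler: update the parameter, then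
sweep through the records. -/
def sampler [SFinite ν] (f : RecordModel X Θ ν) (η : PrivacyMechanism n X S ρ) (s : S)
    (K : Kernel (State n X Θ) Θ) : Kernel (State n X Θ) (State n X Θ) :=
  recordSweep f η s ∘ₖ paramUpdate K

end Sampler

section Ergodicity

variable {E : Type*} [MeasurableSpace E]

/-- The total variation distance `sup_A |P(A) - Q(A)|` over measurable sets `A`. -/
def tvDist (P Q : Measure E) : ℝ≥0∞ :=
  ⨆ (A : Set E) (_ : MeasurableSet A), ENNReal.ofReal |P.real A - Q.real A|

/-- A transition kernel `P` is aperiodic if there is no cycle of `d ≥ 2` non-empty pairwise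
disjoint measurable sets `D 0, …, D (d - 1)` with `P(z, D (k + 1 mod d)) = 1` for all
`z ∈ D k`. -/
def IsAperiodic (P : Kernel E E) : Prop :=
  ¬ ∃ (d : ℕ) (D : ZMod d → Set E), 2 ≤ d ∧ (∀ k, MeasurableSet (D k)) ∧ (∀ k, (D k).Nonempty) ∧
    Pairwise (fun k l => Disjoint (D k) (D l)) ∧ ∀ k, ∀ z ∈ D k, P z (D (k + 1)) = 1

/-- The Markov chain with transition kernel `P` is ergodic with limit the probability
distribution `π`: it is `π`-invariant, `π`-irreducible and aperiodic, and the law of the state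
after `m` steps converges to `π` in total variation from `π`-almost every starting point. -/
structure IsErgodic (P : Kernel E E) (π : Measure E) : Prop where
  isProbabilityMeasure : IsProbabilityMeasure π
  invariant : Kernel.Invariant P π
  irreducible : Kernel.IsIrreducible π P
  aperiodic : IsAperiodic P
  tendsto : ∀ᵐ z ∂π, Tendsto (fun m : ℕ => tvDist ((P ^ m) z) π) atTop (𝓝 0)

end Ergodicity

end PrivacySampler

end

noncomputable section

namespace PrivacySampler

/-! ### Markov chains with an invariant law -/

section GeneralChains

variable {E : Type*} [MeasurableSpace E]

/-! Write `P` for the sampler and `π` for the joint posterior. Invariance is checked update by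
update. The parameter update preserves `π` on each fibre of fixed database. Each record update is in
detailed balance: since the proposal is the model density itself, the likelihood ratio cancels and
only the ratio of `η` remains (`likelihood_mul_acceptProb_symm`).

The rest comes from positivity. A sweep charges whatever the product of `ν` restricted to the common
support `T` charges, and the parameter update charges whatever `μ` charges as soon as the database
is good: all records in `T` and a finite normalising constant. Hence `π ≪ P z` at good states, which
are `π`-almost all states. One step reaches a good database from anywhere, so `π ≪ (P ^ 2) z` for
every `z`. This two-step domination gives irreducibility, aperiodicity and uniqueness: two distinct
invariant laws would have mutually singular invariant excesses over their infimum, both dominating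
`π` (`eq_of_invariant`).

Convergence is a coupling argument (`ae_limGap_eq_zero`). The asymptotic gap between two starting
points is subharmonic for two independent copies of the chain. The one-step laws from almost every
pair overlap, and cancelling the overlap puts the gap strictly below its essential supremum unless
that is zero. By `ae_le_of_subharmonic` the gap then lies almost surely below some smaller level, a
contradiction. -/

theorem isMarkovKernel_pow (P : Kernel E E) [IsMarkovKernel P] (m : ℕ) :
    IsMarkovKernel (P ^ m) := by
  induction m with
  | zero => rw [pow_zero]; exact inferInstanceAs (IsMarkovKernel Kernel.id)
  | succ m ih => rw [pow_succ]; exact inferInstanceAs (IsMarkovKernel ((P ^ m) ∘ₖ P))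

theorem lintegral_invariant {P : Kernel E E} {π : Measure E} (h : Kernel.Invariant P π)
    {g : E → ℝ≥0∞} (hg : Measurable g) : ∫⁻ z, ∫⁻ y, g y ∂(P z) ∂π = ∫⁻ y, g y ∂π := by
  conv_rhs => rw [← h.def]
  rw [Measure.lintegral_bind P.aemeasurable hg.aemeasurable]

theorem invariant_of_lintegral {P : Kernel E E} {π : Measure E}
    (h : ∀ g : E → ℝ≥0∞, Measurable g → ∫⁻ z, ∫⁻ y, g y ∂(P z) ∂π = ∫⁻ y, g y ∂π) :
    Kernel.Invariant P π := by
  refine Measure.ext fun A hA => ?_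
  rw [Measure.bind_apply hA P.aemeasurable]
  simpa [lintegral_indicator_one hA] using h (A.indicator 1) (measurable_one.indicator hA)

theorem Invariant.pow {P : Kernel E E} {π : Measure E} (h : Kernel.Invariant P π) (m : ℕ) :
    Kernel.Invariant (P ^ m) π := by
  induction m with
  | zero => rw [pow_zero]; exact Measure.bind_dirac
  | succ m ih => rw [pow_succ]; exact Kernel.Invariant.comp ih h

/-- The difference of two integrals against measures of the same mass is controlled by
the integrated differences of the integrand. -/
theorem mul_lintegral_sub_lintegral_le {a b : Measure E} [IsFiniteMeasure a] [IsFiniteMeasure b]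
    {t : ℝ≥0∞} (ha : a Set.univ = t) (hb : b Set.univ = t) {g : E → ℝ≥0∞} (hg : Measurable g) :
    t * (∫⁻ z, g z ∂a - ∫⁻ w, g w ∂b) ≤ ∫⁻ p, (g p.1 - g p.2) ∂(a.prod b) := by
  have ht : t ≠ ∞ := ha ▸ measure_ne_top a _
  rw [lintegral_prod _ (by fun_prop)]
  calc t * (∫⁻ z, g z ∂a - ∫⁻ w, g w ∂b)
      = ∫⁻ z, t * g z ∂a - ∫⁻ _, (∫⁻ w, g w ∂b) ∂a := by
        rw [ENNReal.mul_sub fun _ _ => ht, lintegral_const_mul _ hg, lintegral_const, ha,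
          mul_comm (∫⁻ w, g w ∂b)]
    _ ≤ ∫⁻ z, (t * g z - ∫⁻ w, g w ∂b) ∂a := lintegral_sub_le _ _ measurable_const
    _ ≤ ∫⁻ z, ∫⁻ w, (g z - g w) ∂b ∂a := by
        refine lintegral_mono fun z => ?_
        have := lintegral_sub_le (μ := b) g (fun _ => g z) hg
        rwa [lintegral_const, hb, mul_comm] at this

/-- The largest excess of `P^m(z, A)` over `P^m(w, A)` for `A` in a family of sets. -/
def powGap (P : Kernel E E) (𝒜 : Set (Set E)) (m : ℕ) (p : E × E) : ℝ≥0∞ :=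
  ⨆ A ∈ 𝒜, ((P ^ m) p.1 A - (P ^ m) p.2 A)

/-! ### Contraction of the gap between two starting points -/

section PowGap

variable {P : Kernel E E} {𝒜 : Set (Set E)}

theorem measurable_powGap (h𝒜 : 𝒜.Countable) (hm : ∀ A ∈ 𝒜, MeasurableSet A) (m : ℕ) :
    Measurable (powGap P 𝒜 m) := by
  refine Measurable.biSup 𝒜 h𝒜 fun A hA => ?_
  have := Kernel.measurable_coe (P ^ m) (hm A hA)
  fun_prop

theorem powGap_le_one [IsMarkovKernel P] (m : ℕ) (p : E × E) : powGap P 𝒜 m p ≤ 1 := by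
  have := isMarkovKernel_pow P m
  exact iSup₂_le fun A _ => tsub_le_self.trans prob_le_one

/-- The common part `κ` of the two one-step laws cancels in the difference, and the remainders are
coupled independently. With `κ = 0` and `t = 1` this is subharmonicity; with a non-trivial `κ` it is
a strict contraction. -/
theorem mul_powGap_succ_le [IsMarkovKernel P] (hm : ∀ A ∈ 𝒜, MeasurableSet A) (m : ℕ)
    {z w : E} {κ a b : Measure E} [IsFiniteMeasure a] [IsFiniteMeasure b]
    (hz : P z = κ + a) (hw : P w = κ + b) {t : ℝ≥0∞}
    (ha : a Set.univ = t) (hb : b Set.univ = t) :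
    t * powGap P 𝒜 (m + 1) (z, w) ≤ ∫⁻ p, powGap P 𝒜 m p ∂(a.prod b) := by
  have hpow : ∀ (y : E) (A : Set E), MeasurableSet A →
      (P ^ (m + 1)) y A = ∫⁻ u, (P ^ m) u A ∂(P y) := fun y A hA => by
    rw [add_comm, Kernel.pow_add_apply_eq_lintegral _ _ _ _ hA, pow_one]
  simp only [powGap, ENNReal.mul_iSup]
  refine iSup₂_le fun A hA => ?_
  have hg := Kernel.measurable_coe (P ^ m) (hm A hA)
  rw [hpow _ _ (hm A hA), hpow _ _ (hm A hA), hz, hw, lintegral_add_measure,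
    lintegral_add_measure]
  calc t * (∫⁻ u, (P ^ m) u A ∂κ + ∫⁻ u, (P ^ m) u A ∂a
        - (∫⁻ u, (P ^ m) u A ∂κ + ∫⁻ u, (P ^ m) u A ∂b))
      ≤ t * (∫⁻ u, (P ^ m) u A ∂a - ∫⁻ u, (P ^ m) u A ∂b) := by
        refine mul_le_mul' le_rfl (tsub_le_iff_right.2 ?_)
        rw [add_left_comm]
        exact add_le_add le_rfl le_tsub_add
    _ ≤ ∫⁻ p, ((P ^ m) p.1 A - (P ^ m) p.2 A) ∂(a.prod b) :=
        mul_lintegral_sub_lintegral_le ha hb hg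
    _ ≤ _ := lintegral_mono fun p => le_iSup₂ (f := fun A (_ : A ∈ 𝒜) =>
        (P ^ m) p.1 A - (P ^ m) p.2 A) A hA

/-- The asymptotic value of `powGap`. -/
def limGap (P : Kernel E E) (𝒜 : Set (Set E)) (p : E × E) : ℝ≥0∞ :=
  limsup (fun m => powGap P 𝒜 m p) atTop

theorem measurable_limGap (h𝒜 : 𝒜.Countable) (hm : ∀ A ∈ 𝒜, MeasurableSet A) :
    Measurable (limGap P 𝒜) :=
  Measurable.limsup fun m => measurable_powGap h𝒜 hm m

theorem limGap_le_one [IsMarkovKernel P] (p : E × E) : limGap P 𝒜 p ≤ 1 :=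
  limsup_le_of_le (by isBoundedDefault) (Eventually.of_forall fun m => powGap_le_one m p)

theorem mul_limGap_le [IsMarkovKernel P] (h𝒜 : 𝒜.Countable) (hm : ∀ A ∈ 𝒜, MeasurableSet A)
    {z w : E} {κ a b : Measure E} [IsFiniteMeasure a] [IsFiniteMeasure b]
    (hz : P z = κ + a) (hw : P w = κ + b) {t : ℝ≥0∞}
    (ha : a Set.univ = t) (hb : b Set.univ = t) :
    t * limGap P 𝒜 (z, w) ≤ ∫⁻ p, limGap P 𝒜 p ∂(a.prod b) := by
  have ht : t ≠ ∞ := ha ▸ measure_ne_top a _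
  calc t * limGap P 𝒜 (z, w)
      = limsup (fun m => t * powGap P 𝒜 (m + 1) (z, w)) atTop := by
        rw [ENNReal.limsup_const_mul_of_ne_top ht,
          limsup_nat_add (fun m => powGap P 𝒜 m (z, w)) 1, limGap]
    -- The inequality after this one is the reverse Fatou lemma, available because the gaps are
    -- bounded by `1`.
    _ ≤ limsup (fun m => ∫⁻ p, powGap P 𝒜 m p ∂(a.prod b)) atTop :=
        limsup_le_limsup (Eventually.of_forall fun m => mul_powGap_succ_le hm m hz hw ha hb)
    _ ≤ _ := limsup_lintegral_le (fun _ => 1) (measurable_powGap h𝒜 hm)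
        (fun m => Eventually.of_forall (powGap_le_one m)) (by simp)

end PowGap

/-- A bounded subharmonic function of a chain whose transition probabilities dominate the
invariant law lies almost surely below any level it stays below with positive probability. -/
theorem ae_le_of_subharmonic {Q : Kernel E E} [IsMarkovKernel Q] {π : Measure E}
    [IsProbabilityMeasure π] (hinv : Kernel.Invariant Q π) (hac : ∀ᵐ z ∂π, π ≪ Q z)
    {h : E → ℝ≥0∞} (hh : Measurable h) (h1 : ∀ z, h z ≤ 1) (hsub : ∀ z, h z ≤ ∫⁻ y, h y ∂(Q z))
    {c : ℝ≥0∞} (hc : π {z | h z ≤ c} ≠ 0) : ∀ᵐ z ∂π, h z ≤ c := by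
  have hgm : Measurable fun z => h z - c := hh.sub_const c
  have hle : ∀ z, h z - c ≤ ∫⁻ y, (h y - c) ∂(Q z) := fun z => by
    have := lintegral_sub_le (μ := Q z) (fun _ => c) h measurable_const
    rw [lintegral_const, measure_univ, mul_one] at this
    exact (tsub_le_tsub_right (hsub z) c).trans this
  have hfin : ∫⁻ z, (h z - c) ∂π ≠ ∞ := by
    refine ne_top_of_le_ne_top ENNReal.one_ne_top ((lintegral_mono fun z =>
      tsub_le_self.trans (h1 z)).trans ?_)
    simp
  -- By invariance both sides have the same finite integral, so the pointwise inequality is an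
  -- equality almost everywhere. At one point with `h z ≤ c` it then forces `h ≤ c` almost surely
  -- under `Q z`, hence under `π`.
  have heq : (fun z => h z - c) =ᵐ[π] fun z => ∫⁻ y, (h y - c) ∂(Q z) :=
    ae_eq_of_ae_le_of_lintegral_le (Eventually.of_forall hle) hfin
      hgm.lintegral_kernel.aemeasurable (lintegral_invariant hinv hgm).le
  obtain ⟨z, hz, hz1, hz2⟩ : ∃ z, h z ≤ c ∧ (h z - c = ∫⁻ y, (h y - c) ∂(Q z)) ∧ π ≪ Q z := by
    have hfr : ∃ᵐ z ∂π, h z ≤ c := frequently_ae_iff.2 hc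
    exact (hfr.and_eventually (heq.and hac)).exists
  rw [tsub_eq_zero_of_le hz, eq_comm, lintegral_eq_zero_iff hgm] at hz1
  filter_upwards [hz2.ae_le hz1] with y hy
  exact tsub_eq_zero_iff_le.1 hy

/-- A generating algebra approximates every measurable set in `μ + ν`. Testing on a countable
algebra instead of all measurable sets is what keeps `powGap` measurable. The one-sided bound
suffices, since complements reverse the sign. -/
theorem tvDist_le_of_algebra {μ ν : Measure E} [IsProbabilityMeasure μ] [IsProbabilityMeasure ν]
    {𝒜 : Set (Set E)} (h𝒜 : IsSetAlgebra 𝒜)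
    (hgen : ‹MeasurableSpace E› = MeasurableSpace.generateFrom 𝒜) {c : ℝ≥0∞}
    (hc : ∀ A ∈ 𝒜, μ A - ν A ≤ c) : tvDist μ ν ≤ c := by
  have hdense := Measure.MeasureDense.of_generateFrom_isSetAlgebra_finite (μ + ν) h𝒜 hgen
  have key : ∀ A, MeasurableSet A → μ A ≤ ν A + c := by
    intro A hA
    refine ENNReal.le_of_forall_pos_le_add fun ε hε _ => ?_
    obtain ⟨t, ht, hAt⟩ := hdense.approx A hA (measure_ne_top _ _) ε hε
    rw [Measure.add_apply, ENNReal.ofReal_coe_nnreal] at hAt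
    have h1 : μ A ≤ μ t + μ (symmDiff A t) := by
      refine (measure_mono fun x hx => ?_).trans (measure_union_le t (symmDiff A t))
      by_cases h : x ∈ t
      · exact Or.inl h
      · exact Or.inr (Or.inl ⟨hx, h⟩)
    have h2 : ν t ≤ ν A + ν (symmDiff A t) := by
      refine (measure_mono fun x hx => ?_).trans (measure_union_le A (symmDiff A t))
      by_cases h : x ∈ A
      · exact Or.inl h
      · exact Or.inr (Or.inr ⟨hx, h⟩)
    calc μ A ≤ μ t + μ (symmDiff A t) := h1
      _ ≤ (c + ν t) + μ (symmDiff A t) := by gcongr; exact tsub_le_iff_right.1 (hc t ht)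
      _ ≤ (c + (ν A + ν (symmDiff A t))) + μ (symmDiff A t) := by gcongr
      _ = ν A + c + (μ (symmDiff A t) + ν (symmDiff A t)) := by ring
      _ ≤ ν A + c + ε := by gcongr
  refine iSup₂_le fun A hA => ?_
  rcases eq_or_ne c ∞ with rfl | hct
  · exact le_top
  have hreal : ∀ {B C : ℝ≥0∞}, B ≠ ∞ → C ≠ ∞ → B ≤ C + c → B.toReal ≤ C.toReal + c.toReal :=
    fun hB hC h => by
      rw [← ENNReal.toReal_add hC hct]
      exact ENNReal.toReal_mono (ENNReal.add_ne_top.2 ⟨hC, hct⟩) h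
  refine ENNReal.ofReal_le_of_le_toReal (abs_sub_le_iff.2 ⟨?_, ?_⟩)
  · have := hreal (measure_ne_top μ A) (measure_ne_top ν A) (key A hA)
    simp only [Measure.real]; linarith
  · have := hreal (measure_ne_top μ Aᶜ) (measure_ne_top ν Aᶜ) (key Aᶜ hA.compl)
    have e1 := probReal_compl_eq_one_sub (μ := μ) hA
    have e2 := probReal_compl_eq_one_sub (μ := ν) hA
    simp only [Measure.real] at *
    linarith

theorem invariant_parallelComp_self {P : Kernel E E} [IsMarkovKernel P] {π : Measure E}
    [IsProbabilityMeasure π] (hinv : Kernel.Invariant P π) :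
    Kernel.Invariant (P ∥ₖ P) (π.prod π) := by
  -- Moving both coordinates amounts to moving one and then the other.
  have h := Kernel.parallelComp_comp_parallelComp (κ := (Kernel.id : Kernel E E)) (η := P)
    (κ' := P) (η' := (Kernel.id : Kernel E E))
  rw [Kernel.id_comp, Kernel.comp_id] at h
  rw [Kernel.Invariant, ← h, ← Measure.comp_assoc, ← Measure.prod_comp_right, hinv.def,
    ← Measure.prod_comp_left, hinv.def]

/-- Two probability measures dominating a common probability measure overlap. -/
theorem exists_common_part {π μ ν : Measure E} [IsProbabilityMeasure π] [IsProbabilityMeasure μ]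
    [IsProbabilityMeasure ν] (hμ : π ≪ μ) (hν : π ≪ ν) :
    ∃ (κ a b : Measure E) (t : ℝ≥0∞), μ = κ + a ∧ ν = κ + b ∧ a Set.univ = t ∧ b Set.univ = t ∧
      t ≠ 0 ∧ t < 1 ∧ a ≤ μ ∧ b ≤ ν := by
  set r : E → ℝ≥0∞ := fun x => min (μ.rnDeriv π x) (ν.rnDeriv π x) with hr
  have hrm : Measurable r := (Measure.measurable_rnDeriv _ _).min (Measure.measurable_rnDeriv _ _)
  -- The factor one half leaves remainders of mass at least one half even when `μ = ν`, so that `t`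
  -- can later be cancelled.
  set κ : Measure E := (2⁻¹ : ℝ≥0∞) • π.withDensity r with hκ
  have hle : ∀ {ξ : Measure E}, (∀ x, r x ≤ ξ.rnDeriv π x) → π.withDensity r ≤ ξ := fun h =>
    (withDensity_mono (Eventually.of_forall h)).trans (Measure.withDensity_rnDeriv_le _ _)
  have hhalf : κ ≤ π.withDensity r := fun A => by
    rw [hκ, Measure.smul_apply, smul_eq_mul]
    exact mul_le_of_le_one_left' (by simp)
  have hκμ : κ ≤ μ := hhalf.trans (hle fun x => min_le_left _ _)
  have hκν : κ ≤ ν := hhalf.trans (hle fun x => min_le_right _ _)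
  have : IsFiniteMeasure κ := isFiniteMeasure_of_le μ hκμ
  have hmass : ∀ {ξ : Measure E} [IsProbabilityMeasure ξ], κ ≤ ξ →
      (ξ - κ) Set.univ = 1 - κ Set.univ := fun h => by
    rw [Measure.sub_apply .univ h, measure_univ]
  have hpos : κ Set.univ ≠ 0 := by
    rw [hκ, Measure.smul_apply, withDensity_apply _ .univ, Measure.restrict_univ, smul_eq_mul]
    refine mul_ne_zero (by simp) fun h0 => ?_
    rw [lintegral_eq_zero_iff hrm] at h0
    have : ∀ᵐ x ∂π, False := by
      filter_upwards [h0, Measure.rnDeriv_pos' hμ, Measure.rnDeriv_pos' hν] with x h1 h2 h3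
      exact (lt_min h2 h3).ne' h1
    exact IsProbabilityMeasure.ne_zero π (by simpa using this)
  have hhalf_mass : κ Set.univ ≤ 2⁻¹ := by
    rw [hκ, Measure.smul_apply, smul_eq_mul]
    have : π.withDensity r Set.univ ≤ 1 :=
      (hle (ξ := μ) fun x => min_le_left _ _) Set.univ |>.trans prob_le_one
    exact mul_le_of_le_one_right' this
  refine ⟨κ, μ - κ, ν - κ, 1 - κ Set.univ, ?_, ?_, hmass hκμ, hmass hκν, ?_, ?_,
    Measure.sub_le, Measure.sub_le⟩
  · rw [add_comm, Measure.sub_add_cancel_of_le hκμ]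
  · rw [add_comm, Measure.sub_add_cancel_of_le hκν]
  · exact (tsub_pos_of_lt (hhalf_mass.trans_lt (by simp))).ne'
  · exact ENNReal.sub_lt_self ENNReal.one_ne_top one_ne_zero hpos

theorem ae_limGap_eq_zero {P : Kernel E E} [IsMarkovKernel P] {π : Measure E}
    [IsProbabilityMeasure π] (hinv : Kernel.Invariant P π) (hac : ∀ᵐ z ∂π, π ≪ P z)
    {𝒜 : Set (Set E)} (h𝒜 : 𝒜.Countable) (hm : ∀ A ∈ 𝒜, MeasurableSet A) :
    ∀ᵐ p ∂π.prod π, limGap P 𝒜 p = 0 := by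
  have hQinv := invariant_parallelComp_self hinv
  have hhm := measurable_limGap (P := P) h𝒜 hm
  have hac1 : ∀ᵐ p ∂π.prod π, π ≪ P p.1 := Measure.quasiMeasurePreserving_fst.ae hac
  have hac2 : ∀ᵐ p ∂π.prod π, π ≪ P p.2 := Measure.quasiMeasurePreserving_snd.ae hac
  have hQac : ∀ᵐ p ∂π.prod π, π.prod π ≪ (P ∥ₖ P) p := by
    filter_upwards [hac1, hac2] with p h1 h2
    rw [Kernel.parallelComp_apply]
    exact h1.prod h2
  have hsub : ∀ p, limGap P 𝒜 p ≤ ∫⁻ q, limGap P 𝒜 q ∂((P ∥ₖ P) p) := fun p => by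
    rw [Kernel.parallelComp_apply]
    simpa using mul_limGap_le h𝒜 hm (zero_add (P p.1)).symm (zero_add (P p.2)).symm
      measure_univ measure_univ
  set c := essSup (limGap P 𝒜) (π.prod π) with hc
  have hlec : ∀ᵐ p ∂π.prod π, limGap P 𝒜 p ≤ c := ENNReal.ae_le_essSup _
  have hc1 : c ≤ 1 := essSup_le_of_ae_le _ (Eventually.of_forall limGap_le_one)
  -- The transition law may have a part singular to `π.prod π`; invariance still transfers the
  -- almost sure bound to it.
  have hQlec : ∀ᵐ p ∂π.prod π, ∀ᵐ q ∂((P ∥ₖ P) p), limGap P 𝒜 q ≤ c := by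
    rw [← hQinv.def] at hlec
    exact Measure.ae_ae_of_ae_bind (Kernel.aemeasurable _) hlec
  by_contra hne
  have hc0 : c ≠ 0 := fun h0 => hne (by filter_upwards [hlec] with p hp; simpa [h0] using hp)
  have hlt : ∀ᵐ p ∂π.prod π, limGap P 𝒜 p < c := by
    filter_upwards [hac1, hac2, hQlec] with p h1 h2 h3
    obtain ⟨κ, a, b, t, hz, hw, ha, hb, ht0, ht1, haP, hbP⟩ := exists_common_part h1 h2
    have : IsFiniteMeasure a := isFiniteMeasure_of_le _ haP
    have : IsFiniteMeasure b := isFiniteMeasure_of_le _ hbP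
    rw [Kernel.parallelComp_apply] at h3
    have hab : a.prod b ≤ (P p.1).prod (P p.2) := Measure.prod_mono haP hbP
    -- The product of the remainders has mass `t * t`; cancelling one factor leaves the bound `t * c
    -- < c`.
    have hle : t * limGap P 𝒜 p ≤ t * (t * c) := by
      calc t * limGap P 𝒜 p ≤ ∫⁻ q, limGap P 𝒜 q ∂(a.prod b) := mul_limGap_le h𝒜 hm hz hw ha hb
        _ ≤ ∫⁻ _, c ∂(a.prod b) := lintegral_mono_ae (ae_mono hab h3)
        _ = t * (t * c) := by
          rw [lintegral_const, ← Set.univ_prod_univ, Measure.prod_prod, ha, hb]; ring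
    rw [ENNReal.mul_le_mul_iff_right ht0 (ht1.trans ENNReal.one_lt_top).ne] at hle
    refine hle.trans_lt ?_
    calc t * c < 1 * c :=
          (ENNReal.mul_lt_mul_iff_left hc0 (hc1.trans_lt ENNReal.one_lt_top).ne).2 ht1
      _ = c := one_mul c
  -- As the gap is almost surely below `c`, some level `u k < c` bounds it with positive
  -- probability, hence almost surely, against the choice of `c` as essential supremum.
  obtain ⟨u, -, hu, hulim⟩ := exists_seq_strictMono_tendsto' (pos_iff_ne_zero.2 hc0)
  obtain ⟨k, hk⟩ : ∃ k, (π.prod π) {p | limGap P 𝒜 p ≤ u k} ≠ 0 := by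
    by_contra! hall
    have h0 : ∀ᵐ p ∂π.prod π, False := by
      have := ae_all_iff.2 fun k => (measure_eq_zero_iff_ae_notMem.1 (hall k))
      filter_upwards [hlt, this] with p hp hp'
      obtain ⟨k, hk⟩ := (hulim.eventually (lt_mem_nhds hp)).exists
      exact hp' k hk.le
    exact IsProbabilityMeasure.ne_zero (π.prod π) (by simpa using h0)
  exact (essSup_le_of_ae_le _ (ae_le_of_subharmonic hQinv hQac hhm limGap_le_one hsub hk)).not_gt
    (hu k).2

/-- A Markov chain with an invariant probability law `π` on a countably generated space whose
transition probabilities dominate `π` converges to `π` in total variation. -/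
theorem ae_tendsto_tvDist [MeasurableSpace.CountablyGenerated E] {P : Kernel E E}
    [IsMarkovKernel P] {π : Measure E} [IsProbabilityMeasure π] (hinv : Kernel.Invariant P π)
    (hac : ∀ᵐ z ∂π, π ≪ P z) :
    ∀ᵐ z ∂π, Tendsto (fun m : ℕ => tvDist ((P ^ m) z) π) atTop (𝓝 0) := by
  set 𝒜 := generateSetAlgebra (MeasurableSpace.countableGeneratingSet E)
  have h𝒜 : 𝒜.Countable :=
    countable_generateSetAlgebra MeasurableSpace.countable_countableGeneratingSet
  have hgen : ‹MeasurableSpace E› = MeasurableSpace.generateFrom 𝒜 := by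
    rw [generateFrom_generateSetAlgebra_eq, MeasurableSpace.generateFrom_countableGeneratingSet]
  have hm : ∀ A ∈ 𝒜, MeasurableSet A := fun A hA => by
    rw [hgen]; exact MeasurableSpace.measurableSet_generateFrom hA
  filter_upwards [Measure.ae_ae_of_ae_prod (ae_limGap_eq_zero hinv hac h𝒜 hm)] with z hz
  have hmeas : ∀ m, Measurable fun w => powGap P 𝒜 m (z, w) := fun m =>
    (measurable_powGap h𝒜 hm m).comp measurable_prodMk_left
  have hbound : ∀ m, tvDist ((P ^ m) z) π ≤ ∫⁻ w, powGap P 𝒜 m (z, w) ∂π := fun m => by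
    have := isMarkovKernel_pow P m
    refine tvDist_le_of_algebra isSetAlgebra_generateSetAlgebra hgen fun A hA => ?_
    have hA' := Kernel.measurable_coe (P ^ m) (hm A hA)
    -- Since `π` is its own average after `m` steps, the distance to `π` is at most the average gap
    -- to a starting point drawn from `π`.
    have hπ : π A = ∫⁻ w, (P ^ m) w A ∂π := by
      conv_lhs => rw [← (Invariant.pow hinv m).def]
      rw [Measure.bind_apply (hm A hA) (Kernel.aemeasurable _)]
    calc (P ^ m) z A - π A = ∫⁻ _, (P ^ m) z A ∂π - ∫⁻ w, (P ^ m) w A ∂π := by simp [hπ]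
      _ ≤ ∫⁻ w, ((P ^ m) z A - (P ^ m) w A) ∂π := lintegral_sub_le _ _ hA'
      _ ≤ _ := lintegral_mono fun w => le_iSup₂ (f := fun A (_ : A ∈ 𝒜) =>
          (P ^ m) z A - (P ^ m) w A) A hA
  have hlim : limsup (fun m => ∫⁻ w, powGap P 𝒜 m (z, w) ∂π) atTop ≤ 0 := by
    refine (limsup_lintegral_le (fun _ => 1) hmeas
      (fun m => Eventually.of_forall fun w => powGap_le_one m (z, w)) (by simp)).trans ?_
    exact ((lintegral_congr_ae hz).trans lintegral_zero).le
  exact tendsto_of_le_liminf_of_limsup_le bot_le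
    ((limsup_le_limsup (Eventually.of_forall hbound)).trans hlim)

/-! ### Uniqueness of the invariant law, limiting laws and aperiodicity -/

theorem absolutelyContinuous_of_invariant {P : Kernel E E} {π μ : Measure E}
    (hac : ∀ z, π ≪ (P ^ 2) z) (hinv : Kernel.Invariant P μ) (hμ : μ ≠ 0) : π ≪ μ := by
  refine Measure.AbsolutelyContinuous.mk fun A hA h0 => ?_
  rw [← (Invariant.pow hinv 2).def, Measure.bind_apply hA (Kernel.aemeasurable _),
    lintegral_eq_zero_iff (Kernel.measurable_coe _ hA)] at h0
  -- Invariance makes `(P ^ 2) z A` vanish for almost every `z`, and a single such `z` is enough.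
  have : NeBot (ae μ) := ae_neBot.2 hμ
  obtain ⟨z, hz⟩ := h0.exists
  exact hac z hz

theorem eq_of_le_of_measure_univ_eq {μ ν : Measure E} [IsFiniteMeasure ν] (h : μ ≤ ν)
    (huniv : μ Set.univ = ν Set.univ) : μ = ν := by
  have : IsFiniteMeasure μ := isFiniteMeasure_of_le ν h
  have h0 : (ν - μ) Set.univ = 0 := by rw [Measure.sub_apply .univ h, huniv, tsub_self]
  rw [← Measure.sub_add_cancel_of_le h, Measure.measure_univ_eq_zero.1 h0, zero_add]

theorem bind_mono_left {P : Kernel E E} {μ ν : Measure E} (h : μ ≤ ν) : μ.bind P ≤ ν.bind P :=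
  Measure.le_iff.2 fun A hA => by
    rw [Measure.bind_apply hA P.aemeasurable, Measure.bind_apply hA P.aemeasurable]
    exact lintegral_mono' h le_rfl

theorem measure_univ_bind {P : Kernel E E} [IsMarkovKernel P] (μ : Measure E) :
    (μ.bind P) Set.univ = μ Set.univ := by
  rw [Measure.bind_apply .univ P.aemeasurable]; simp

theorem Invariant.sub {P : Kernel E E} {μ κ : Measure E} [IsFiniteMeasure μ] [IsFiniteMeasure κ]
    (hμ : Kernel.Invariant P μ) (hκ : Kernel.Invariant P κ) (h : κ ≤ μ) :
    Kernel.Invariant P (μ - κ) := by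
  have h1 : (μ - κ).bind P + κ = μ := by
    calc (μ - κ).bind P + κ = (μ - κ).bind P + κ.bind P := by rw [hκ.def]
      _ = (μ - κ + κ).bind P := Measure.comp_add.symm
      _ = μ := by rw [Measure.sub_add_cancel_of_le h, hμ.def]
  rw [Kernel.Invariant]
  conv_rhs => rw [← h1, Measure.add_sub_cancel]

/-- One step maps the infimum below both laws, hence below itself, and preserves mass. -/
theorem Invariant.inf {P : Kernel E E} [IsMarkovKernel P] {μ ν : Measure E} [IsFiniteMeasure μ]
    (hμ : Kernel.Invariant P μ) (hν : Kernel.Invariant P ν) : Kernel.Invariant P (μ ⊓ ν) := by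
  have : IsFiniteMeasure (μ ⊓ ν) := isFiniteMeasure_of_le μ inf_le_left
  refine eq_of_le_of_measure_univ_eq (le_inf ?_ ?_) (measure_univ_bind _)
  · exact (bind_mono_left inf_le_left).trans hμ.def.le
  · exact (bind_mono_left inf_le_right).trans hν.def.le

theorem mutuallySingular_sub_inf (μ ν : Measure E) [IsFiniteMeasure μ] [IsFiniteMeasure ν] :
    (μ - μ ⊓ ν) ⟂ₘ (ν - μ ⊓ ν) := by
  have : IsFiniteMeasure (μ ⊓ ν) := isFiniteMeasure_of_le μ inf_le_left
  obtain ⟨H, hH, h1, h2⟩ := hahn_decomposition μ ν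
  -- On each half of the Hahn decomposition keep the smaller measure. The infimum thus exhausts `ν`
  -- on `H` and `μ` on `Hᶜ`.
  have hle : ν.restrict H + μ.restrict Hᶜ ≤ μ ⊓ ν := by
    refine le_inf (Measure.le_iff.2 fun A hA => ?_) (Measure.le_iff.2 fun A hA => ?_) <;>
      rw [Measure.add_apply, Measure.restrict_apply hA, Measure.restrict_apply hA]
    · have e := measure_inter_add_sdiff (μ := μ) A hH
      rw [Set.sdiff_eq] at e
      exact (add_le_add (h1 _ (hA.inter hH) Set.inter_subset_right) le_rfl).trans_eq e
    · have e := measure_inter_add_sdiff (μ := ν) A hH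
      rw [Set.sdiff_eq] at e
      exact (add_le_add le_rfl (h2 _ (hA.inter hH.compl) Set.inter_subset_right)).trans_eq e
  refine ⟨Hᶜ, hH.compl, ?_, ?_⟩
  · rw [Measure.sub_apply hH.compl inf_le_left, tsub_eq_zero_iff_le]
    refine le_trans ?_ (hle Hᶜ)
    simp [Measure.restrict_apply hH.compl]
  · rw [compl_compl, Measure.sub_apply hH inf_le_right, tsub_eq_zero_iff_le]
    refine le_trans ?_ (hle H)
    simp [Measure.restrict_apply hH]

/-- A chain whose two-step transition probabilities all dominate a fixed non-zero measure has at
most one invariant probability law. -/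
theorem eq_of_invariant {P : Kernel E E} [IsMarkovKernel P] {π μ ν : Measure E} (hπ : π ≠ 0)
    (hac : ∀ z, π ≪ (P ^ 2) z) [IsProbabilityMeasure μ] [IsProbabilityMeasure ν]
    (hμ : Kernel.Invariant P μ) (hν : Kernel.Invariant P ν) : μ = ν := by
  have : IsFiniteMeasure (μ ⊓ ν) := isFiniteMeasure_of_le μ inf_le_left
  have hi := Invariant.inf hμ hν
  have hmass : (μ - μ ⊓ ν) Set.univ = (ν - μ ⊓ ν) Set.univ := by
    rw [Measure.sub_apply .univ inf_le_left, Measure.sub_apply .univ inf_le_right, measure_univ (μ := μ),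
      measure_univ (μ := ν)]
  by_cases h0 : μ - μ ⊓ ν = 0
  · have h0' : ν - μ ⊓ ν = 0 := by
      rw [← Measure.measure_univ_eq_zero, ← hmass, h0]; simp
    rw [← Measure.sub_add_cancel_of_le (inf_le_left : μ ⊓ ν ≤ μ), h0, ← h0',
      Measure.sub_add_cancel_of_le inf_le_right]
  · have h0' : ν - μ ⊓ ν ≠ 0 := fun h => h0 (by
      rw [← Measure.measure_univ_eq_zero, hmass, h]; simp)
    have h1 := absolutelyContinuous_of_invariant hac (Invariant.sub hμ hi inf_le_left) h0
    have h2 := absolutelyContinuous_of_invariant hac (Invariant.sub hν hi inf_le_right) h0'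
    exact absurd (Measure.eq_zero_of_absolutelyContinuous_of_mutuallySingular h1
      ((mutuallySingular_sub_inf μ ν).symm.mono_ac h2 .rfl).symm.symm) hπ

theorem measure_le_add_tvDist (μ ν : Measure E) [IsFiniteMeasure μ] [IsFiniteMeasure ν]
    {A : Set E} (hA : MeasurableSet A) : μ A ≤ ν A + tvDist μ ν := by
  have h : ENNReal.ofReal |μ.real A - ν.real A| ≤ tvDist μ ν :=
    le_iSup₂ (f := fun A (_ : MeasurableSet A) => ENNReal.ofReal |μ.real A - ν.real A|) A hA
  calc μ A = ENNReal.ofReal (μ.real A) := (ofReal_measureReal).symm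
    _ ≤ ENNReal.ofReal (ν.real A + |μ.real A - ν.real A|) :=
        ENNReal.ofReal_le_ofReal (by linarith [le_abs_self (μ.real A - ν.real A)])
    _ ≤ ν A + ENNReal.ofReal |μ.real A - ν.real A| := by
        refine ENNReal.ofReal_add_le.trans_eq ?_
        rw [ofReal_measureReal]
    _ ≤ _ := by gcongr

theorem tvDist_comm (μ ν : Measure E) : tvDist μ ν = tvDist ν μ := by
  simp only [tvDist, abs_sub_comm]

theorem lintegral_le_add_tvDist (μ ν : Measure E) [IsFiniteMeasure μ] [IsFiniteMeasure ν]
    {g : E → ℝ≥0∞} (hg : Measurable g) (hg1 : ∀ z, g z ≤ 1) :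
    ∫⁻ z, g z ∂μ ≤ ∫⁻ z, g z ∂ν + tvDist μ ν := by
  -- Layer-cake formula: a function bounded by `1` has only levels in an interval of length `1`, so
  -- the set-wise error `tvDist μ ν` integrates to itself.
  have hcake : ∀ ξ : Measure E,
      ∫⁻ z, g z ∂ξ = ∫⁻ t in Set.Ioc (0 : ℝ) 1, ξ {z | t ≤ (g z).toReal} := fun ξ => by
    have h := lintegral_eq_lintegral_meas_le ξ (f := fun z => (g z).toReal)
      (Eventually.of_forall fun z => ENNReal.toReal_nonneg) hg.ennreal_toReal.aemeasurable
    simp only [ENNReal.ofReal_toReal ((hg1 _).trans_lt ENNReal.one_lt_top).ne] at h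
    rw [h, ← Set.Ioc_union_Ioi_eq_Ioi (zero_le_one' ℝ),
      lintegral_union measurableSet_Ioi (Set.Ioc_disjoint_Ioi le_rfl),
      setLIntegral_congr_fun (g := fun _ => 0) measurableSet_Ioi, lintegral_zero, add_zero]
    intro t ht
    have : {z | t ≤ (g z).toReal} = ∅ := Set.eq_empty_of_forall_notMem fun z hz => by
      have : (g z).toReal ≤ 1 := ENNReal.toReal_mono ENNReal.one_ne_top (hg1 z)
      exact absurd (hz.trans this) (not_le.2 ht)
    simp [this]
  rw [hcake μ, hcake ν]
  calc _ ≤ ∫⁻ t in Set.Ioc (0 : ℝ) 1, (ν {z | t ≤ (g z).toReal} + tvDist μ ν) :=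
        lintegral_mono fun t =>
          measure_le_add_tvDist μ ν (measurableSet_le measurable_const hg.ennreal_toReal)
    _ = _ := by
        rw [lintegral_add_right _ measurable_const]
        simp

/-- A limit in total variation of the laws of a Markov chain is invariant. -/
theorem invariant_of_tendsto_tvDist {P : Kernel E E} [IsMarkovKernel P] {π : Measure E}
    [IsProbabilityMeasure π] {z : E}
    (h : Tendsto (fun m : ℕ => tvDist ((P ^ m) z) π) atTop (𝓝 0)) : Kernel.Invariant P π := by
  have : ∀ m, IsMarkovKernel (P ^ m) := isMarkovKernel_pow P
  have h' := h.comp (tendsto_add_atTop_nat 1)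
  -- Only `π.bind P ≤ π` is needed, as both have mass `1`.
  have hle : ∀ A, MeasurableSet A → (π.bind P) A ≤ π A := fun A hA => by
    have hg := Kernel.measurable_coe P hA
    have hlim : Tendsto (fun m : ℕ => π A + tvDist ((P ^ (m + 1)) z) π + tvDist ((P ^ m) z) π)
        atTop (𝓝 (π A + 0 + 0)) := (tendsto_const_nhds.add h').add h
    rw [add_zero, add_zero] at hlim
    refine ge_of_tendsto' hlim fun m => ?_
    rw [Measure.bind_apply hA P.aemeasurable]
    calc ∫⁻ y, P y A ∂π ≤ ∫⁻ y, P y A ∂((P ^ m) z) + tvDist π ((P ^ m) z) :=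
          lintegral_le_add_tvDist _ _ hg fun _ => prob_le_one
      _ = (P ^ (m + 1)) z A + tvDist ((P ^ m) z) π := by
          rw [Kernel.pow_succ_apply_eq_lintegral _ _ _ hA, tvDist_comm]
      _ ≤ _ := by gcongr; exact measure_le_add_tvDist _ _ hA
  exact eq_of_le_of_measure_univ_eq (Measure.le_iff.2 hle) (measure_univ_bind π)

theorem isAperiodic_of_ac {P : Kernel E E} [IsMarkovKernel P] {π : Measure E}
    [IsProbabilityMeasure π] (hac : ∀ z, π ≪ (P ^ 2) z) : IsAperiodic P := by
  rintro ⟨d, D, hd, hDm, hDne, hdisj, hstep⟩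
  -- Two steps from `D k` end in `D (k + 2)`, so every class would have full `π`-measure; two
  -- disjoint classes contradict this.
  have hnull : ∀ k, π (D (k + 1 + 1))ᶜ = 0 := fun k => by
    obtain ⟨z, hz⟩ := hDne k
    refine hac z ?_
    have hP : ∀ l, ∀ y ∈ D l, P y (D (l + 1))ᶜ = 0 := fun l y hy =>
      (prob_compl_eq_zero_iff (hDm _)).2 (hstep l y hy)
    rw [Kernel.pow_succ_apply_eq_lintegral _ 1 _ (hDm _).compl, pow_one,
      lintegral_eq_zero_iff (Kernel.measurable_coe _ (hDm _).compl)]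
    filter_upwards [measure_eq_zero_iff_ae_notMem.1 (hP k z hz)] with y hy
    exact hP _ y (by simpa using hy)
  have : Fact (1 < d) := ⟨hd⟩
  have h0 := hnull (-1 - 1)
  have h1 := hnull (-1)
  have hd01 : Disjoint (D (-1 - 1 + 1 + 1)) (D (-1 + 1 + 1)) :=
    hdisj (by simp)
  have : π Set.univ = 0 := by
    refine measure_mono_null (fun z _ => ?_) (measure_union_null h0 h1)
    by_cases hz : z ∈ D (-1 - 1 + 1 + 1)
    · exact Or.inr (hd01.notMem_of_mem_left hz)
    · exact Or.inl hz
  simp at this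

end GeneralChains

/-! ### Integration one coordinate at a time -/

theorem countablyGenerated_pi {ι α : Type*} [Finite ι] [MeasurableSpace α]
    [MeasurableSpace.CountablyGenerated α] : MeasurableSpace.CountablyGenerated (ι → α) := by
  have : ∀ i : ι, ∃ b : Set (Set (ι → α)), b.Countable ∧
      MeasurableSpace.comap (fun x : ι → α => x i) ‹_› = MeasurableSpace.generateFrom b := fun i =>
    (MeasurableSpace.CountablyGenerated.comap (fun x : ι → α => x i)).isCountablyGenerated
  choose b hb hgen using this
  refine ⟨⋃ i, b i, Set.countable_iUnion hb, ?_⟩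
  rw [← MeasurableSpace.iSup_generateFrom]
  exact iSup_congr hgen

theorem measurable_update_pair {ι α : Type*} [DecidableEq ι] [MeasurableSpace α] (i : ι) :
    Measurable fun p : (ι → α) × α => Function.update p.1 i p.2 := by
  refine measurable_pi_iff.2 fun j => ?_
  by_cases h : j = i
  · subst h; simpa using measurable_snd
  · simp only [Function.update_of_ne h]; fun_prop

/-- Exchanging the `i`-th coordinate of `x` with an independent copy preserves the measure. -/
theorem lintegral_pi_exchange {ι α : Type*} [Fintype ι] [DecidableEq ι] [MeasurableSpace α]
    (ν : Measure α) [SigmaFinite ν] (i : ι) {G : (ι → α) × α → ℝ≥0∞} (hG : Measurable G) :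
    ∫⁻ x, ∫⁻ y, G (Function.update x i y, x i) ∂ν ∂(Measure.pi fun _ => ν) =
      ∫⁻ x, ∫⁻ y, G (x, y) ∂ν ∂(Measure.pi fun _ => ν) := by
  have hu := measurable_update_pair (α := α) i
  have h1 : Measurable fun p : (ι → α) × α => G (Function.update p.1 i p.2, p.1 i) :=
    hG.comp (hu.prodMk ((measurable_pi_apply i).comp measurable_fst))
  refine lintegral_eq_of_lmarginal_eq {i} h1.lintegral_prod_right' hG.lintegral_prod_right' ?_
  rw [lmarginal_singleton, lmarginal_singleton]
  -- With the other coordinates frozen, the exchange is Tonelli's theorem in two variables.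
  funext x
  simp only [Function.update_idem, Function.update_self]
  refine lintegral_lintegral_swap (f := fun u y => G (Function.update x i y, u)) ?_
  exact (hG.comp ((hu.comp (measurable_const.prodMk measurable_snd)).prodMk
    measurable_fst)).aemeasurable

/-- A Metropolis-Hastings update of the `i`-th coordinate in detailed balance with the weight `w`
preserves integrals against `w`. -/
theorem lintegral_coordinate_update {ι α : Type*} [Fintype ι] [DecidableEq ι] [MeasurableSpace α]
    (ν : Measure α) [SigmaFinite ν] (i : ι) {w F : (ι → α) → ℝ≥0∞} {q : α → ℝ≥0∞}
    {a b : (ι → α) × α → ℝ≥0∞} (hw : Measurable w) (hF : Measurable F) (hq : Measurable q)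
    (ha : Measurable a) (hb : Measurable b) (hq1 : ∫⁻ y, q y ∂ν = 1) (hab : ∀ p, a p + b p = 1)
    (hsymm : ∀ x y, w (Function.update x i y) * (q (x i) * a (Function.update x i y, x i)) =
      w x * (q y * a (x, y))) :
    ∫⁻ x, w x * ∫⁻ y, q y * (a (x, y) * F (Function.update x i y) + b (x, y) * F x) ∂ν
      ∂(Measure.pi fun _ => ν) = ∫⁻ x, w x * F x ∂(Measure.pi fun _ => ν) := by
  have hu : Measurable fun p : (ι → α) × α => Function.update p.1 i p.2 := measurable_update_pair i
  -- By `hsymm` the exchanged integrand is the flow of accepted moves, which may thus be counted at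
  -- its starting point. It then recombines with the rejected part through `a + b = 1`.
  have hex := lintegral_pi_exchange ν i (G := fun p => w p.1 * (q p.2 * a p) * F p.1)
    (by fun_prop)
  simp only [hsymm] at hex
  have hm1 : Measurable fun p : (ι → α) × α =>
      w p.1 * (q p.2 * a p) * F (Function.update p.1 i p.2) := by fun_prop
  have hm2 : Measurable fun p : (ι → α) × α => w p.1 * (q p.2 * a p) * F p.1 := by fun_prop
  calc _ = ∫⁻ x, (∫⁻ y, w x * (q y * a (x, y)) * F (Function.update x i y) ∂ν +
          ∫⁻ y, w x * (q y * b (x, y)) * F x ∂ν) ∂(Measure.pi fun _ => ν) := by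
        refine lintegral_congr fun x => ?_
        have hx : Measurable fun y => w x * (q y * a (x, y)) * F (Function.update x i y) :=
          hm1.comp measurable_prodMk_left
        rw [← lintegral_const_mul _ (by fun_prop), ← lintegral_add_left hx]
        exact lintegral_congr fun y => by ring
    _ = ∫⁻ x, (∫⁻ y, w x * (q y * a (x, y)) * F x ∂ν +
          ∫⁻ y, w x * (q y * b (x, y)) * F x ∂ν) ∂(Measure.pi fun _ => ν) := by
        rw [lintegral_add_left hm1.lintegral_prod_right', hex,
          ← lintegral_add_left hm2.lintegral_prod_right']
    _ = _ := by
        refine lintegral_congr fun x => ?_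
        have hx : Measurable fun y => w x * (q y * a (x, y)) * F x :=
          hm2.comp measurable_prodMk_left
        rw [← lintegral_add_left hx]
        calc _ = ∫⁻ y, (w x * F x) * q y ∂ν := lintegral_congr fun y => by
              calc _ = w x * F x * q y * (a (x, y) + b (x, y)) := by ring
                _ = _ := by rw [hab, mul_one]
          _ = w x * F x := by rw [lintegral_const_mul _ hq, hq1, mul_one]

section Model

variable {n : ℕ} {X Θ S : Type*} [MeasurableSpace X] [MeasurableSpace Θ] [MeasurableSpace S]
  {ν : Measure X} {ρ : Measure S} (f : RecordModel X Θ ν) (η : PrivacyMechanism n X S ρ) (s : S)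

theorem RecordModel.measurable_density_left (θ : Θ) : Measurable (f.density θ) :=
  f.measurable_density.comp measurable_prodMk_left

theorem PrivacyMechanism.measurable_density_right : Measurable (η.density s) :=
  η.measurable_density.comp measurable_prodMk_left

theorem measurable_acceptProb_pair (i : Fin n) :
    Measurable fun p : (Fin n → X) × X => acceptProb η s i p.1 p.2 := by
  have h := η.measurable_density_right s
  exact ((h.comp (measurable_update_pair i)).div (h.comp measurable_fst)).min measurable_const

theorem measurable_likelihood : Measurable fun z : State n X Θ => likelihood f z.1 z.2 :=
  Finset.measurable_prod _ fun i _ =>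
    f.measurable_density.comp (measurable_snd.prodMk ((measurable_pi_apply i).comp measurable_fst))

theorem measurable_jointDensity {prior : Θ → ℝ≥0} (hprior : Measurable prior) :
    Measurable fun z : State n X Θ =>
      ((prior z.2 * likelihood f z.1 z.2 * η.density s z.1 : ℝ≥0) : ℝ≥0∞) :=
  (((hprior.comp measurable_snd).mul (measurable_likelihood f)).mul
    ((η.measurable_density_right s).comp measurable_fst)).coe_nnreal_ennreal

theorem measurable_paramDensity {prior : Θ → ℝ≥0} (hprior : Measurable prior) :
    Measurable fun z : State n X Θ => ((prior z.2 * likelihood f z.1 z.2 : ℝ≥0) : ℝ≥0∞) :=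
  ((hprior.comp measurable_snd).mul (measurable_likelihood f)).coe_nnreal_ennreal

/-- The detailed balance identity of the accept/reject step. -/
theorem likelihood_mul_acceptProb_symm (hη : ∀ x, 0 < η.density s x) (i : Fin n) (θ : Θ)
    (x : Fin n → X) (y : X) :
    likelihood f (Function.update x i y) θ * η.density s (Function.update x i y) *
        (f.density θ (x i) * acceptProb η s i (Function.update x i y) (x i)) =
      likelihood f x θ * η.density s x * (f.density θ y * acceptProb η s i x y) := by
  -- The product is symmetric in the current and the proposed database.
  have hacc : ∀ (x : Fin n → X) (y : X), η.density s x * acceptProb η s i x y =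
      min (η.density s (Function.update x i y)) (η.density s x) := fun x y => by
    rw [acceptProb, mul_min, mul_div_cancel₀ _ (hη x).ne', mul_one]
  have hlik : ∀ (x : Fin n → X), likelihood f x θ =
      f.density θ (x i) * ∏ j ∈ Finset.univ.erase i, f.density θ (x j) := fun x =>
    (Finset.mul_prod_erase _ _ (Finset.mem_univ i)).symm
  have hrest : ∏ j ∈ Finset.univ.erase i, f.density θ (Function.update x i y j) =
      ∏ j ∈ Finset.univ.erase i, f.density θ (x j) :=
    Finset.prod_congr rfl fun j hj => by rw [Function.update_of_ne (Finset.ne_of_mem_erase hj)]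
  have h1 := hacc x y
  have h2 := hacc (Function.update x i y) (x i)
  rw [Function.update_idem, Function.update_eq_self, min_comm, ← h1] at h2
  rw [hlik x, hlik (Function.update x i y), hrest, Function.update_self]
  linear_combination (f.density θ y * (∏ j ∈ Finset.univ.erase i, f.density θ (x j)) *
    f.density θ (x i)) * h2

/-! ### Integrals against the kernels of the sampler -/

section Kernels

variable [SFinite ν]

theorem proposal_apply (z : State n X Θ) :
    proposal n f z = ν.withDensity fun y => (f.density z.2 y : ℝ≥0∞) := by
  rw [proposal, Kernel.withDensity_apply, Kernel.const_apply]
  exact (f.measurable_density.comp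
    ((measurable_snd.comp measurable_fst).prodMk measurable_snd)).coe_nnreal_ennreal

instance isMarkovKernel_proposal : IsMarkovKernel (proposal n f) :=
  ⟨fun z => ⟨by
    rw [proposal_apply, withDensity_apply _ .univ, Measure.restrict_univ]
    exact f.lintegral_density z.2⟩⟩

instance isMarkovKernel_acceptReject (i : Fin n) :
    IsMarkovKernel (acceptReject (Θ := Θ) η s i) :=
  ⟨fun w => ⟨by
    change ((acceptProb η s i w.1.1 w.2 : ℝ≥0∞) •
      Measure.dirac (Function.update w.1.1 i w.2, w.1.2)
      + ((1 - acceptProb η s i w.1.1 w.2 : ℝ≥0) : ℝ≥0∞) • Measure.dirac w.1) Set.univ = 1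
    have h : acceptProb η s i w.1.1 w.2 ≤ 1 := min_le_right _ _
    simp only [Measure.add_apply, Measure.smul_apply, measure_univ, smul_eq_mul, mul_one]
    rw [← ENNReal.coe_add, add_tsub_cancel_of_le h, ENNReal.coe_one]⟩⟩

instance isMarkovKernel_recordUpdate (i : Fin n) : IsMarkovKernel (recordUpdate f η s i) := by
  unfold recordUpdate; infer_instance

theorem lintegral_recordUpdate (i : Fin n) (z : State n X Θ) {F : State n X Θ → ℝ≥0∞}
    (hF : Measurable F) :
    ∫⁻ z', F z' ∂(recordUpdate f η s i z) =
      ∫⁻ y, (f.density z.2 y : ℝ≥0∞) *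
        (acceptProb η s i z.1 y * F (Function.update z.1 i y, z.2) +
          (1 - acceptProb η s i z.1 y : ℝ≥0) * F z) ∂ν := by
  have happly : ∀ w : State n X Θ × X, ∫⁻ z', F z' ∂(acceptReject η s i w) =
      acceptProb η s i w.1.1 w.2 * F (Function.update w.1.1 i w.2, w.1.2) +
          (1 - acceptProb η s i w.1.1 w.2 : ℝ≥0) * F w.1 := fun w => by
    change ∫⁻ z', F z' ∂((acceptProb η s i w.1.1 w.2 : ℝ≥0∞) •
      Measure.dirac (Function.update w.1.1 i w.2, w.1.2)
      + ((1 - acceptProb η s i w.1.1 w.2 : ℝ≥0) : ℝ≥0∞) • Measure.dirac w.1) = _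
    rw [lintegral_add_measure, lintegral_smul_measure, lintegral_smul_measure,
      lintegral_dirac' _ hF, lintegral_dirac' _ hF]
    rfl
  rw [recordUpdate, Kernel.lintegral_comp _ _ _ hF,
    Kernel.lintegral_id_prod hF.lintegral_kernel, proposal_apply,
    lintegral_withDensity_eq_lintegral_mul ν
      (f.measurable_density_left z.2).coe_nnreal_ennreal
      (g := fun y => ∫⁻ z', F z' ∂(acceptReject η s i (z, y)))
      (hF.lintegral_kernel.comp measurable_prodMk_left)]
  simp only [happly, Pi.mul_apply]

instance isMarkovKernel_foldl_recordUpdate (l : List (Fin n)) :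
    IsMarkovKernel (l.foldl (fun κ i => recordUpdate f η s i ∘ₖ κ) Kernel.id) := by
  induction l using List.reverseRecOn with
  | nil => exact inferInstanceAs (IsMarkovKernel Kernel.id)
  | append_singleton l i ih =>
    rw [List.foldl_append]
    exact inferInstanceAs (IsMarkovKernel (recordUpdate f η s i ∘ₖ _))

instance isMarkovKernel_recordSweep : IsMarkovKernel (recordSweep f η s) :=
  isMarkovKernel_foldl_recordUpdate f η s _

variable (K : Kernel (State n X Θ) Θ) [IsMarkovKernel K]

instance isMarkovKernel_paramUpdate : IsMarkovKernel (paramUpdate K) := by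
  unfold paramUpdate; infer_instance

instance isMarkovKernel_sampler : IsMarkovKernel (sampler f η s K) := by
  unfold sampler; infer_instance

theorem lintegral_paramUpdate (z : State n X Θ) {F : State n X Θ → ℝ≥0∞} (hF : Measurable F) :
    ∫⁻ z', F z' ∂(paramUpdate K z) = ∫⁻ θ, F (z.1, θ) ∂(K z) := by
  rw [paramUpdate, Kernel.lintegral_deterministic_prod _ _ _ hF]

theorem sampler_apply (z : State n X Θ) {A : Set (State n X Θ)} (hA : MeasurableSet A) :
    sampler f η s K z A = ∫⁻ θ, recordSweep f η s (z.1, θ) A ∂(K z) := by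
  rw [sampler, Kernel.comp_apply' _ _ _ hA, lintegral_paramUpdate K z (Kernel.measurable_coe _ hA)]

end Kernels

/-! ### Invariance of the joint posterior -/

section Invariance

variable {μ : Measure Θ} [SigmaFinite μ] {prior : Θ → ℝ≥0}

theorem lintegral_jointWeight (hprior : Measurable prior) {F : State n X Θ → ℝ≥0∞}
    (hF : Measurable F) :
    ∫⁻ z, F z ∂(jointWeight μ prior f η s) = ∫⁻ x, (η.density s x : ℝ≥0∞) *
      ∫⁻ θ, F (x, θ) ∂(paramWeight μ prior f x) ∂(Measure.pi fun _ => ν) := by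
  rw [jointWeight, lintegral_withDensity_eq_lintegral_mul _
    (measurable_jointDensity f η s hprior) hF, lintegral_prod _
    ((measurable_jointDensity f η s hprior).mul hF).aemeasurable]
  refine lintegral_congr fun x => ?_
  have hFx : Measurable fun θ => F (x, θ) := hF.comp measurable_prodMk_left
  have hd : Measurable fun θ => ((prior θ * likelihood f x θ : ℝ≥0) : ℝ≥0∞) :=
    (measurable_paramDensity f hprior).comp measurable_prodMk_left
  rw [paramWeight, lintegral_withDensity_eq_lintegral_mul _ hd hFx,
    ← lintegral_const_mul _ (hd.mul hFx)]
  refine lintegral_congr fun θ => ?_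
  simp only [Pi.mul_apply, ENNReal.coe_mul]
  ring

theorem measurable_paramWeight_univ (hprior : Measurable prior) :
    Measurable fun x : Fin n → X => paramWeight μ prior f x Set.univ := by
  simp only [paramWeight, withDensity_apply _ MeasurableSet.univ, Measure.restrict_univ]
  exact (measurable_paramDensity f hprior).lintegral_prod_right'

/-- By Tonelli `p(s)` is the integral of `η` times the normalising constant. It is finite and `η` is
positive, so the constant is finite almost everywhere, and only there is anything known about the
parameter kernel. -/
theorem ae_paramWeight_ne_top [SigmaFinite ν] (hprior : Measurable prior)
    (hs : jointWeight μ prior f η s Set.univ ≠ ∞) (hη : ∀ x, 0 < η.density s x) :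
    ∀ᵐ x ∂(Measure.pi fun _ : Fin n => ν), paramWeight μ prior f x Set.univ ≠ ∞ := by
  have h := lintegral_jointWeight f η s (μ := μ) hprior (F := fun _ => 1) measurable_const
  simp only [lintegral_const, one_mul] at h
  rw [h] at hs
  filter_upwards [ae_lt_top (((η.measurable_density_right s).coe_nnreal_ennreal).mul
    (measurable_paramWeight_univ f hprior)) hs] with x hx htop
  simp [htop, ENNReal.mul_top, (hη x).ne'] at hx

theorem invariant_paramUpdate_jointWeight [SigmaFinite ν] (hprior : Measurable prior)
    (hs : jointWeight μ prior f η s Set.univ ≠ ∞) (hη : ∀ x, 0 < η.density s x)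
    (K : Kernel (State n X Θ) Θ) [IsMarkovKernel K] (hK : TargetsPosterior μ prior f K) :
    Kernel.Invariant (paramUpdate K) (jointWeight μ prior f η s) := by
  refine invariant_of_lintegral fun F hF => ?_
  rw [lintegral_jointWeight f η s hprior hF.lintegral_kernel,
    lintegral_jointWeight f η s hprior hF]
  refine lintegral_congr_ae ?_
  filter_upwards [ae_paramWeight_ne_top f η s hprior hs hη] with x hx
  congr 1
  simp only [lintegral_paramUpdate K _ hF]
  by_cases h0 : paramWeight μ prior f x Set.univ = 0
  · simp [Measure.measure_univ_eq_zero.1 h0]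
  · have h := lintegral_invariant (hK x h0 hx).1 (g := fun θ => F (x, θ))
      (hF.comp measurable_prodMk_left)
    simp only [paramPosterior, normalize, lintegral_smul_measure, smul_eq_mul,
      Kernel.sectR_apply] at h
    exact (ENNReal.mul_right_inj (ENNReal.inv_ne_zero.2 hx) (ENNReal.inv_ne_top.2 h0)).1 h

theorem invariant_recordUpdate_jointWeight [SigmaFinite ν] (hprior : Measurable prior)
    (hη : ∀ x, 0 < η.density s x) (i : Fin n) :
    Kernel.Invariant (recordUpdate f η s i) (jointWeight μ prior f η s) := by
  refine invariant_of_lintegral fun F hF => ?_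
  have hw := measurable_jointDensity f η s hprior
  rw [jointWeight, lintegral_withDensity_eq_lintegral_mul _ hw hF.lintegral_kernel,
    lintegral_withDensity_eq_lintegral_mul _ hw hF, lintegral_prod_symm _
    (hw.mul hF.lintegral_kernel).aemeasurable, lintegral_prod_symm _ (hw.mul hF).aemeasurable]
  refine lintegral_congr fun θ => ?_
  simp only [Pi.mul_apply, lintegral_recordUpdate f η s i _ hF]
  have hα := measurable_acceptProb_pair η s i
  refine lintegral_coordinate_update ν i (F := fun x => F (x, θ))
    (w := fun x => ((prior θ * likelihood f x θ * η.density s x : ℝ≥0) : ℝ≥0∞))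
    (q := fun y => (f.density θ y : ℝ≥0∞))
    (a := fun p => (acceptProb η s i p.1 p.2 : ℝ≥0∞))
    (b := fun p => ((1 - acceptProb η s i p.1 p.2 : ℝ≥0) : ℝ≥0∞))
    (hw.comp measurable_prodMk_right) (hF.comp measurable_prodMk_right)
    (f.measurable_density_left θ).coe_nnreal_ennreal hα.coe_nnreal_ennreal
    (measurable_const.sub hα).coe_nnreal_ennreal (f.lintegral_density θ) (fun p => ?_)
    (fun x y => ?_)
  · have h1 : acceptProb η s i p.1 p.2 ≤ 1 := min_le_right _ _
    rw [← ENNReal.coe_add, add_tsub_cancel_of_le h1, ENNReal.coe_one]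
  · simp only [← ENNReal.coe_mul, mul_assoc (prior θ)]
    rw [likelihood_mul_acceptProb_symm f η s hη]

theorem invariant_recordSweep_jointWeight [SigmaFinite ν] (hprior : Measurable prior)
    (hη : ∀ x, 0 < η.density s x) :
    Kernel.Invariant (recordSweep f η s) (jointWeight μ prior f η s) := by
  unfold recordSweep
  induction List.finRange n using List.reverseRecOn with
  | nil => exact Measure.bind_dirac
  | append_singleton l i ih =>
    rw [List.foldl_append]
    exact (invariant_recordUpdate_jointWeight f η s hprior hη i).comp ih

theorem invariant_sampler_jointPosterior [SigmaFinite ν] (hprior : Measurable prior)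
    (hs : jointWeight μ prior f η s Set.univ ≠ ∞) (hη : ∀ x, 0 < η.density s x)
    (K : Kernel (State n X Θ) Θ) [IsMarkovKernel K] (hK : TargetsPosterior μ prior f K) :
    Kernel.Invariant (sampler f η s K) (jointPosterior μ prior f η s) := by
  have h : Kernel.Invariant (sampler f η s K) (jointWeight μ prior f η s) :=
    (invariant_recordSweep_jointWeight f η s hprior hη).comp
      (invariant_paramUpdate_jointWeight f η s hprior hs hη K hK)
  rw [jointPosterior, normalize, Kernel.Invariant, Measure.comp_smul, h.def]

end Invariance

/-! ### Sets charged by the sampler -/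

section Positivity

variable {T : Set X}

/-- Proposal density and acceptance probability are both positive on `T`, so the accepted part alone
charges every new record in `T`. -/
theorem setLIntegral_eq_zero_of_recordUpdate [SFinite ν]
    (hT : ∀ θ x, 0 < f.density θ x ↔ x ∈ T) (hTm : MeasurableSet T)
    (hη : ∀ x, 0 < η.density s x) (i : Fin n) (z : State n X Θ) {F : State n X Θ → ℝ≥0∞}
    (hF : Measurable F) (h0 : ∫⁻ z', F z' ∂(recordUpdate f η s i z) = 0) :
    ∫⁻ y in T, F (Function.update z.1 i y, z.2) ∂ν = 0 := by
  have hα : Measurable fun y => acceptProb η s i z.1 y := by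
    have h := (measurable_acceptProb_pair η s i).comp (measurable_prodMk_left (x := z.1))
    simpa only [Function.comp_def] using h
  have hup : Measurable fun y : X => Function.update z.1 i y :=
    (measurable_update_pair i).comp measurable_prodMk_left
  have hu : Measurable fun y => F (Function.update z.1 i y, z.2) :=
    hF.comp (hup.prodMk measurable_const)
  have hfm := (f.measurable_density_left z.2).coe_nnreal_ennreal
  rw [lintegral_recordUpdate f η s i _ hF, lintegral_eq_zero_iff (by fun_prop)] at h0
  rw [lintegral_eq_zero_iff hu]
  refine (ae_restrict_iff' hTm).2 ?_
  filter_upwards [h0] with y hy hyT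
  have hfy : (f.density z.2 y : ℝ≥0∞) ≠ 0 := by simpa using ((hT z.2 y).2 hyT).ne'
  have hay : (acceptProb η s i z.1 y : ℝ≥0∞) ≠ 0 := by
    have : 0 < acceptProb η s i z.1 y := lt_min (div_pos (hη _) (hη _)) one_pos
    simpa using this.ne'
  simp only [Pi.zero_apply, mul_eq_zero, add_eq_zero, hfy, hay, false_or] at hy
  exact hy.1

/-- A sweep over the records in `l` reaches every configuration of these records in the common
support `T` of the model. -/
theorem lmarginal_eq_zero_of_lintegral_foldl_eq_zero [SigmaFinite ν]
    (hT : ∀ θ x, 0 < f.density θ x ↔ x ∈ T) (hTm : MeasurableSet T)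
    (hη : ∀ x, 0 < η.density s x) (z : State n X Θ) (l : List (Fin n)) (hl : l.Nodup)
    {F : State n X Θ → ℝ≥0∞} (hF : Measurable F)
    (h0 : ∫⁻ z', F z' ∂(l.foldl (fun κ i => recordUpdate f η s i ∘ₖ κ) Kernel.id z) = 0) :
    (∫⋯∫⁻_l.toFinset, (fun x => F (x, z.2)) ∂(fun _ => ν.restrict T)) z.1 = 0 := by
  induction l using List.reverseRecOn generalizing F with
  | nil =>
    rw [List.foldl_nil, Kernel.id_apply, lintegral_dirac' _ hF] at h0
    simpa using h0
  | append_singleton l i ih =>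
    rw [List.foldl_append, List.foldl_cons, List.foldl_nil, Kernel.lintegral_comp _ _ _ hF] at h0
    have hl' : l.Nodup ∧ i ∉ l := by
      rw [List.nodup_append] at hl
      exact ⟨hl.1, fun hi => hl.2.2 i hi i (by simp) rfl⟩
    have hG := ih hl'.1 hF.lintegral_kernel h0
    have hins : (l ++ [i]).toFinset = insert i l.toFinset := by ext j; simp
    have hFθ : Measurable fun x : Fin n → X => F (x, z.2) := hF.comp measurable_prodMk_right
    rw [hins, lmarginal_insert' _ hFθ (by simpa using hl'.2)]
    refine le_antisymm ?_ bot_le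
    -- Only null sets matter: multiplying by `∞` gives `0` where the update integral vanishes and
    -- `∞` elsewhere. It thus dominates the marginal over record `i`, and its integral is still zero
    -- by induction.
    calc _ ≤ (∫⋯∫⁻_l.toFinset, (fun x => ∞ * ∫⁻ z', F z' ∂(recordUpdate f η s i (x, z.2)))
          ∂(fun _ => ν.restrict T)) z.1 := by
          refine lmarginal_mono (fun x => ?_) z.1
          by_cases hx : ∫⁻ z', F z' ∂(recordUpdate f η s i (x, z.2)) = 0
          · exact (setLIntegral_eq_zero_of_recordUpdate f η s hT hTm hη i (x, z.2) hF hx).trans_le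
              bot_le
          · rw [ENNReal.top_mul hx]; exact le_top
      _ = 0 := by
          rw [lmarginal, lintegral_const_mul]
          · exact mul_eq_zero.2 (Or.inr hG)
          · exact hF.lintegral_kernel.comp
              ((measurable_updateFinset).prodMk measurable_const)

theorem pi_restrict_eq_zero_of_recordSweep_eq_zero [SigmaFinite ν]
    (hT : ∀ θ x, 0 < f.density θ x ↔ x ∈ T) (hTm : MeasurableSet T)
    (hη : ∀ x, 0 < η.density s x) (z : State n X Θ) {A : Set (State n X Θ)}
    (hA : MeasurableSet A) (h0 : recordSweep f η s z A = 0) :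
    (Measure.pi fun _ : Fin n => ν.restrict T) {x | (x, z.2) ∈ A} = 0 := by
  have h := lmarginal_eq_zero_of_lintegral_foldl_eq_zero f η s hT hTm hη z (List.finRange n)
    (List.nodup_finRange n) (measurable_one.indicator hA)
    (by rw [lintegral_indicator_one hA]; exact h0)
  have hu : (List.finRange n).toFinset = Finset.univ := by ext; simp
  rw [hu, lmarginal_univ] at h
  have hA' : MeasurableSet {x : Fin n → X | (x, z.2) ∈ A} := measurable_prodMk_right hA
  rw [← lintegral_indicator_one hA']
  exact h

theorem likelihood_pos (hT : ∀ θ x, 0 < f.density θ x ↔ x ∈ T) {x : Fin n → X}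
    (hx : ∀ i, x i ∈ T) (θ : Θ) : 0 < likelihood f x θ :=
  Finset.prod_pos fun i _ => (hT θ (x i)).2 (hx i)

theorem absolutelyContinuous_paramWeight {μ : Measure Θ} {prior : Θ → ℝ≥0}
    (hprior : Measurable prior)
    (hpos : ∀ θ, 0 < prior θ)
    (hT : ∀ θ x, 0 < f.density θ x ↔ x ∈ T) {x : Fin n → X} (hx : ∀ i, x i ∈ T) :
    μ ≪ paramWeight μ prior f x := by
  refine withDensity_absolutelyContinuous'
    ((measurable_paramDensity f hprior).comp measurable_prodMk_left).aemeasurable ?_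
  refine Eventually.of_forall fun θ => ?_
  simpa using ⟨(hpos θ).ne', (likelihood_pos f hT hx θ).ne'⟩

/-- From a database at which the parameter posterior is well defined, the parameter update charges
every set of positive `μ`-measure. -/
theorem absolutelyContinuous_of_targetsPosterior {μ : Measure Θ} {prior : Θ → ℝ≥0}
    (hprior : Measurable prior)
    (hpos : ∀ θ, 0 < prior θ) (hT : ∀ θ x, 0 < f.density θ x ↔ x ∈ T)
    {K : Kernel (State n X Θ) Θ} (hK : TargetsPosterior μ prior f K) {z : State n X Θ}
    (hz : ∀ i, z.1 i ∈ T) (h0 : paramWeight μ prior f z.1 Set.univ ≠ 0)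
    (htop : paramWeight μ prior f z.1 Set.univ ≠ ∞) : μ ≪ K z := by
  refine Measure.AbsolutelyContinuous.mk fun B hB hKB => ?_
  by_contra hμB
  refine ((hK z.1 h0 htop).2 z.2 B hB ?_).ne' hKB
  rw [paramPosterior, normalize, Measure.smul_apply, smul_eq_mul, pos_iff_ne_zero]
  exact mul_ne_zero (ENNReal.inv_ne_zero.2 htop) fun h =>
    hμB (absolutelyContinuous_paramWeight f hprior hpos hT hz h)

variable {μ : Measure Θ} [SigmaFinite μ] {prior : Θ → ℝ≥0}

theorem jointWeight_absolutelyContinuous [SigmaFinite ν]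
    (hT : ∀ θ x, 0 < f.density θ x ↔ x ∈ T) (hTm : MeasurableSet T) :
    jointWeight μ prior f η s ≪ (Measure.pi fun _ : Fin n => ν.restrict T).prod μ := by
  have hTn : MeasurableSet ((Set.univ.pi fun _ : Fin n => T) ×ˢ (Set.univ : Set Θ)) :=
    (MeasurableSet.univ_pi fun _ => hTm).prod .univ
  -- The density vanishes as soon as one record leaves `T`, so restricting to databases in `T` costs
  -- nothing.
  have hind : (fun z : State n X Θ =>
      ((prior z.2 * likelihood f z.1 z.2 * η.density s z.1 : ℝ≥0) : ℝ≥0∞)) =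
      ((Set.univ.pi fun _ : Fin n => T) ×ˢ (Set.univ : Set Θ)).indicator fun z : State n X Θ =>
      ((prior z.2 * likelihood f z.1 z.2 * η.density s z.1 : ℝ≥0) : ℝ≥0∞) := by
    refine (Set.indicator_eq_self.2 fun z hz => Set.mem_prod.2 ⟨fun i _ => ?_, Set.mem_univ _⟩).symm
    rw [← hT z.2, pos_iff_ne_zero]
    intro hi
    refine hz ?_
    have : likelihood f z.1 z.2 = 0 := Finset.prod_eq_zero (Finset.mem_univ i) hi
    simp [this]
  rw [jointWeight, hind, withDensity_indicator hTn, ← Measure.prod_restrict,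
    Measure.restrict_univ, Measure.restrict_pi_pi]
  exact withDensity_absolutelyContinuous _ _

theorem jointWeight_absolutelyContinuous_sampler [SigmaFinite ν]
    (hT : ∀ θ x, 0 < f.density θ x ↔ x ∈ T) (hTm : MeasurableSet T)
    (hη : ∀ x, 0 < η.density s x) {K : Kernel (State n X Θ) Θ} [IsMarkovKernel K]
    {z : State n X Θ} (hz : μ ≪ K z) :
    jointWeight μ prior f η s ≪ sampler f η s K z := by
  refine (jointWeight_absolutelyContinuous f η s hT hTm).trans
    (Measure.AbsolutelyContinuous.mk fun A hA h0 => ?_)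
  have hm : Measurable fun θ => recordSweep f η s (z.1, θ) A :=
    (Kernel.measurable_coe _ hA).comp measurable_prodMk_left
  rw [sampler_apply f η s K z hA, lintegral_eq_zero_iff hm] at h0
  rw [Measure.prod_apply_symm hA, lintegral_eq_zero_iff (measurable_measure_prodMk_right hA)]
  filter_upwards [hz.ae_le h0] with θ hθ
  exact pi_restrict_eq_zero_of_recordSweep_eq_zero f η s hT hTm hη (z.1, θ) hA hθ

/-- The sampler reaches, from any state, every set of databases that the base measure on the
support of the model charges. -/
theorem sampler_fst_preimage_ne_zero [SigmaFinite ν]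
    (hT : ∀ θ x, 0 < f.density θ x ↔ x ∈ T) (hTm : MeasurableSet T)
    (hη : ∀ x, 0 < η.density s x) {K : Kernel (State n X Θ) Θ} [IsMarkovKernel K]
    (z : State n X Θ) {G : Set (Fin n → X)} (hG : MeasurableSet G)
    (hG0 : (Measure.pi fun _ : Fin n => ν.restrict T) G ≠ 0) :
    sampler f η s K z (Prod.fst ⁻¹' G) ≠ 0 := by
  intro h0
  have hA : MeasurableSet (Prod.fst ⁻¹' G : Set (State n X Θ)) := measurable_fst hG
  have hm : Measurable fun θ => recordSweep f η s (z.1, θ) (Prod.fst ⁻¹' G) :=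
    (Kernel.measurable_coe _ hA).comp measurable_prodMk_left
  rw [sampler_apply f η s K z hA, lintegral_eq_zero_iff hm] at h0
  obtain ⟨θ, hθ⟩ := h0.exists
  exact hG0 (pi_restrict_eq_zero_of_recordSweep_eq_zero f η s hT hTm hη (z.1, θ) hA hθ)

theorem jointWeight_univ_ne_zero [SigmaFinite ν] (hprior : Measurable prior)
    (hpos : ∀ θ, 0 < prior θ) (hT : ∀ θ x, 0 < f.density θ x ↔ x ∈ T)
    (hη : ∀ x, 0 < η.density s x) (hμ : μ ≠ 0) (hTν : ν T ≠ 0) :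
    jointWeight μ prior f η s Set.univ ≠ 0 := by
  rw [jointWeight, withDensity_apply _ .univ, Measure.restrict_univ]
  intro h0
  rw [lintegral_eq_zero_iff (measurable_jointDensity f η s hprior)] at h0
  have hnull : ((Measure.pi fun _ : Fin n => ν).prod μ)
      ((Set.univ.pi fun _ : Fin n => T) ×ˢ (Set.univ : Set Θ)) = 0 := by
    refine measure_mono_null (t := {z | _}ᶜ) (fun z hz hz0 => ?_) h0
    have hl := likelihood_pos f hT (fun i => hz.1 i trivial) z.2
    have hpz : 0 < prior z.2 * likelihood f z.1 z.2 * η.density s z.1 :=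
      mul_pos (mul_pos (hpos z.2) hl) (hη z.1)
    exact hpz.ne' (by simpa using hz0)
  rw [Measure.prod_prod, Measure.pi_pi] at hnull
  simp [hTν, hμ] at hnull

end Positivity

end Model

end PrivacySampler

end

/-! ### The ergodic theorem for the sampler -/

theorem mainTheorem3 {n : ℕ} {X Θ S : Type*}
    [MeasurableSpace X] [MeasurableSpace.CountablyGenerated X]
    [MeasurableSpace Θ] [MeasurableSpace.CountablyGenerated Θ] [MeasurableSpace S]
    (ν : Measure X) [SigmaFinite ν] (μ : Measure Θ) [SigmaFinite μ] (ρ : Measure S)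
    (f : PrivacySampler.RecordModel X Θ ν) (η : PrivacySampler.PrivacyMechanism n X S ρ)
    (prior : Θ → ℝ≥0) (hprior : Measurable prior) (s : S)
    -- the kernel used for the conditional update of the parameter
    (K : Kernel (PrivacySampler.State n X Θ) Θ) [IsMarkovKernel K]
    (hK : PrivacySampler.TargetsPosterior μ prior f K)
    -- the joint posterior is well defined: `p(s) < ∞`
    (hs : PrivacySampler.jointWeight μ prior f η s Set.univ ≠ ∞)
    -- the prior is proper, and positive on `{θ ∣ f(x ∣ θ) > 0 for some x}`
    (hproper : ∫⁻ θ, (prior θ : ℝ≥0∞) ∂μ = 1)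
    (hpos : ∀ θ ∈ {θ : Θ | ∃ x : X, 0 < f.density θ x}, 0 < prior θ)
    -- the support of the model does not depend on the parameter
    (hsupp : ∀ θ θ' : Θ, {x : X | 0 < f.density θ x} = {x : X | 0 < f.density θ' x})
    -- the privacy mechanism is positive at the observed output
    (hη : ∀ x : Fin n → X, 0 < η.density s x) :
    -- the sampler is ergodic with limit the joint posterior
    PrivacySampler.IsErgodic (PrivacySampler.sampler f η s K)
        (PrivacySampler.jointPosterior μ prior f η s) ∧
    -- the joint posterior is the only invariant distribution
    (∀ π : Measure (PrivacySampler.State n X Θ), IsProbabilityMeasure π →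
      Kernel.Invariant (PrivacySampler.sampler f η s K) π →
        π = PrivacySampler.jointPosterior μ prior f η s) ∧
    -- the joint posterior is the only limiting distribution, from any starting point
    (∀ (π : Measure (PrivacySampler.State n X Θ)) (z : PrivacySampler.State n X Θ),
      IsProbabilityMeasure π →
      Tendsto (fun m : ℕ => PrivacySampler.tvDist ((PrivacySampler.sampler f η s K ^ m) z) π)
        atTop (𝓝 0) →
          π = PrivacySampler.jointPosterior μ prior f η s) := by
  have hμ : μ ≠ 0 := by rintro rfl; simp at hproper
  have hΘ : Nonempty Θ := by
    by_contra h
    rw [not_nonempty_iff] at h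
    exact hμ (Measure.eq_zero_of_isEmpty μ)
  obtain ⟨θ₀⟩ := hΘ
  set T : Set X := {x | 0 < f.density θ₀ x} with hTdef
  have hT : ∀ θ x, 0 < f.density θ x ↔ x ∈ T := fun θ x => by
    rw [hTdef, ← hsupp θ θ₀, Set.mem_ofPred_eq]
  have hTm : MeasurableSet T := measurableSet_lt measurable_const (f.measurable_density_left θ₀)
  have hTν : ν T ≠ 0 := fun h0 => by
    have h1 := f.lintegral_density θ₀
    rw [lintegral_congr_ae (g := fun _ => 0), lintegral_zero] at h1
    · exact zero_ne_one h1
    · filter_upwards [measure_eq_zero_iff_ae_notMem.1 h0] with x hx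
      simpa [hTdef] using hx
  have hpos' : ∀ θ, 0 < prior θ := fun θ => hpos θ <| by
    obtain ⟨x, hx⟩ := nonempty_of_measure_ne_zero hTν
    exact ⟨x, (hT θ x).2 hx⟩
  have hW0 := PrivacySampler.jointWeight_univ_ne_zero f η s (μ := μ) hprior hpos' hT hη hμ hTν
  have hprob : IsProbabilityMeasure (PrivacySampler.jointPosterior μ prior f η s) := ⟨by
    rw [PrivacySampler.jointPosterior, PrivacySampler.normalize, Measure.smul_apply, smul_eq_mul,
      ENNReal.inv_mul_cancel hW0 hs]⟩
  have hac : PrivacySampler.jointPosterior μ prior f η s ≪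
      PrivacySampler.jointWeight μ prior f η s :=
    Measure.smul_absolutelyContinuous
  -- The good databases, where the hypothesis on `K` applies. A zero normalising constant is
  -- excluded by positivity of the prior and of the likelihood.
  set G : Set (Fin n → X) := (Set.univ.pi fun _ => T) ∩
    {x | PrivacySampler.paramWeight μ prior f x Set.univ ≠ ∞} with hGdef
  have hGm : MeasurableSet G := (MeasurableSet.univ_pi fun _ => hTm).inter
    (PrivacySampler.measurable_paramWeight_univ f hprior (measurableSet_singleton ∞).compl)
  have hKG : ∀ z : PrivacySampler.State n X Θ, z.1 ∈ G → μ ≪ K z := fun z hz => by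
    have hzT : ∀ i, z.1 i ∈ T := fun i => hz.1 i trivial
    refine PrivacySampler.absolutelyContinuous_of_targetsPosterior f hprior hpos' hT hK hzT
      (fun h => ?_) hz.2
    exact hμ (Measure.measure_univ_eq_zero.1
      (PrivacySampler.absolutelyContinuous_paramWeight f hprior hpos' hT hzT h))
  have hGae : ∀ᵐ x ∂(Measure.pi fun _ : Fin n => ν.restrict T), x ∈ G := by
    rw [← Measure.restrict_pi_pi]
    filter_upwards [ae_restrict_mem (MeasurableSet.univ_pi fun _ : Fin n => hTm),
      ae_restrict_of_ae (PrivacySampler.ae_paramWeight_ne_top f η s hprior hs hη)] with x h1 h2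
    exact ⟨h1, h2⟩
  have hG0 : (Measure.pi fun _ : Fin n => ν.restrict T) G ≠ 0 := fun h0 => by
    have huniv : (Measure.pi fun _ : Fin n => ν.restrict T) Set.univ = 0 := by
      rw [← Set.union_compl_self G]
      exact measure_union_null h0 hGae
    rw [Measure.pi_univ] at huniv
    simp [hTν] at huniv
  have hinv := PrivacySampler.invariant_sampler_jointPosterior f η s hprior hs hη K hK
  have hac1 : ∀ z : PrivacySampler.State n X Θ, z.1 ∈ G →
      PrivacySampler.jointPosterior μ prior f η s ≪ PrivacySampler.sampler f η s K z :=
    fun z hz => hac.trans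
      (PrivacySampler.jointWeight_absolutelyContinuous_sampler f η s hT hTm hη (hKG z hz))
  have hac1' : ∀ᵐ z ∂(PrivacySampler.jointPosterior μ prior f η s),
      PrivacySampler.jointPosterior μ prior f η s ≪ PrivacySampler.sampler f η s K z := by
    have hprod := hac.trans (PrivacySampler.jointWeight_absolutelyContinuous
      (μ := μ) (prior := prior) f η s hT hTm)
    filter_upwards [hprod.ae_le (Measure.quasiMeasurePreserving_fst.ae hGae)] with z hz
    exact hac1 z hz
  -- Nothing is known of `K` at a bad starting database, but whatever parameter it draws, the sweep
  -- reaches `G` with positive probability. The second step then starts from a good state.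
  have hac2 : ∀ z, PrivacySampler.jointPosterior μ prior f η s ≪
      (PrivacySampler.sampler f η s K ^ 2) z := fun z =>
    Measure.AbsolutelyContinuous.mk fun A hA h0 => by
      rw [Kernel.pow_succ_apply_eq_lintegral _ 1 _ hA, pow_one,
        lintegral_eq_zero_iff (Kernel.measurable_coe _ hA)] at h0
      have hfreq : ∃ᵐ z' ∂(PrivacySampler.sampler f η s K z), z'.1 ∈ G := frequently_ae_iff.2
        (PrivacySampler.sampler_fst_preimage_ne_zero f η s hT hTm hη z hGm hG0)
      obtain ⟨z', hz'G, hz'0⟩ := (hfreq.and_eventually h0).exists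
      exact hac1 z' hz'G hz'0
  have huniq : ∀ π : Measure (PrivacySampler.State n X Θ), IsProbabilityMeasure π →
      Kernel.Invariant (PrivacySampler.sampler f η s K) π →
        π = PrivacySampler.jointPosterior μ prior f η s := fun π _ hπ =>
    PrivacySampler.eq_of_invariant (IsProbabilityMeasure.ne_zero _) hac2 hπ hinv
  have hcg : MeasurableSpace.CountablyGenerated (Fin n → X) := PrivacySampler.countablyGenerated_pi
  refine ⟨⟨hprob, hinv, ⟨fun A _ hA z => ⟨2, ?_⟩⟩, PrivacySampler.isAperiodic_of_ac hac2,
    PrivacySampler.ae_tendsto_tvDist hinv hac1'⟩, huniq, fun π z _ h =>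
    huniq π inferInstance (PrivacySampler.invariant_of_tendsto_tvDist h)⟩
  exact pos_iff_ne_zero.2 fun h => hA.ne' (hac2 z h)
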